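/- Let $(p_k)_{k\ge 0}$ be a probability distribution on the non-negative integers with $p_1\neq 1$, with generating function $f(s)=\sum_{k\ge0}p_ks^k$, so that $f(1)=1$. Suppose that it is critical, $f'(1)=\sum_{k}k\,p_k=1$, and that $\sum_{k\ge 2}p_k\,k^3\ln k<\infty$. Let $(Z_t)_{t\ge0}$ be the continuous-time Markov branching process with $Z_0=1$ in which each particle lives for an exponential time with parameter $1$ and is replaced at its death by a random number of new particles with distribution $(p_k)$, all life lengths and offspring numbers being independent. For $n\ge 3$ put $$f_n(x)=\sum_{i_1,\dots,i_n\ge 0}p_{i_1+\dots+i_n+n-1}\,x^{i_n},$$ so that for $x\in[0,1)$ $$f_3(x)=\frac{f(x)-x}{(1-x)^2},\qquad f_4(x)=\frac{m_2-f_3(x)}{1-x},\qquad f_5(x)=\frac{m_3-f_4(x)}{1-x},$$ where $m_2=f_3(1)=\tfrac12 f''(1)$ and $m_3=f_4(1)=\tfrac16 f'''(1)$, and let $$\psi_{1,1}(x)=\frac{f_4(x)^2}{m_2^2\,f_3(x)}-\frac{f_5(x)}{m_2^2},\qquad x\in[0,1).$$ Then $\psi_{1,1}$ is integrable on $[0,s]$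 for each $s\in[0,1)$, there is exactly one real sequence $(h_k)_{k\ge1}$ such that $$\sum_{k=1}^\infty h_ks^k=\frac1{m_2^2}\,\frac{s}{1-s}+\frac{m_3}{m_2^3}\,\ln\frac1{1-s}+\frac1{m_2}\int_0^s\psi_{1,1}(x)\,dx,\qquad s\in[0,1),$$ and for each $k\ge1$ $$\mathbb P(Z_t=k)\sim\frac{h_k}{t^2},\qquad t\to\infty.$$ -/

import Mathlib

open MeasureTheory ProbabilityTheory Filter Asymptotics

/-- The population is encoded by the Ulam-Harris tree: a potential particle is a finite list of
natural numbers, `[]` is the ancestor, and the list `[i₁, …, iₙ]` is the `iₙ`-th child of the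
`iₙ₋₁`-th child of … of the `i₁`-th child of the ancestor (children are numbered from `0`).
If particle `u` has `X u` children, `isBorn X u` says that `u` is ever born. The family
`fun w => X (i :: w)` describes the descendants of the `i`-th child of the ancestor. -/
def isBorn (X : List ℕ → ℕ) : List ℕ → Prop
  | [] => True
  | i :: v => i < X [] ∧ isBorn (fun w => X (i :: w)) v

/-- The birth time of particle `u` is the sum of the life lengths of its strict ancestors; the
ancestor of the population is born at time `0`. -/
def birthTime (L : List ℕ → ℝ) : List ℕ → ℝ
  | [] => 0
  | i :: v => L [] + birthTime (fun w => L (i :: w)) v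

/-- The population size `Z_t`: the number of particles that are alive at time `t`, when `L u` is
the life length of particle `u`, and `X u` is the number of children replacing `u` at its death. -/
noncomputable def populationSize (L : List ℕ → ℝ) (X : List ℕ → ℕ) (t : ℝ) : ℕ∞ :=
  {u : List ℕ | isBorn X u ∧ birthTime L u ≤ t ∧ t < birthTime L u + L u}.encard

/-- The random mechanism of the Markov branching process with reproduction law `p`: all life
lengths `L u` are exponential with parameter `1`, all offspring numbers `X u` have distribution `p`,
and all these random variables are independent (the pairs `(L u, X u)` are independent for different
`u`, and the two entries of each pair are independent). -/
structure IsBranchingMechanism {Ω : Type*} [MeasurableSpace Ω] (μ : Measure Ω) (p : ℕ → ℝ)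
    (L : List ℕ → Ω → ℝ) (X : List ℕ → Ω → ℕ) : Prop where
  measurable_life : ∀ u, Measurable (L u)
  measurable_offspring : ∀ u, Measurable (X u)
  life_law : ∀ u, μ.map (L u) = expMeasure 1
  offspring_law : ∀ u k, μ.real {ω | X u ω = k} = p k
  indep_life_offspring : ∀ u, IndepFun (L u) (X u) μ
  indep_particles : iIndepFun (fun u ω => (L u ω, X u ω)) μ

/-- The tail generating function of order `n ≥ 1` of the power series `∑ v_k s^k`:
`v^{(n)}(s_1, …, s_n) = ∑_{i_1, …, i_n ≥ 0} v_{i_1 + … + i_n + n - 1} s_1^{i_1} ⋯ s_n^{i_n}`. -/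
noncomputable def tailGF (v : ℕ → ℝ) (n : ℕ) (s : Fin n → ℝ) : ℝ :=
  ∑' i : Fin n → ℕ, v (∑ j, i j + n - 1) * ∏ j, s j ^ i j

/-- `f_3(x) = f^{(3)}(1, 1, x)` for `f(s) = ∑ p_k s^k`. -/
noncomputable def tail3 (p : ℕ → ℝ) (x : ℝ) : ℝ := tailGF p 3 ![1, 1, x]

/-- `f_4(x) = f^{(4)}(1, 1, 1, x)`. -/
noncomputable def tail4 (p : ℕ → ℝ) (x : ℝ) : ℝ := tailGF p 4 ![1, 1, 1, x]

/-- `f_5(x) = f^{(5)}(1, 1, 1, 1, x)`. -/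
noncomputable def tail5 (p : ℕ → ℝ) (x : ℝ) : ℝ := tailGF p 5 ![1, 1, 1, 1, x]

/-- `m_2 = f_3(1) = f''(1) / 2`. -/
noncomputable def moment2 (p : ℕ → ℝ) : ℝ := tail3 p 1

/-- `m_3 = f_4(1) = f'''(1) / 6`. -/
noncomputable def moment3 (p : ℕ → ℝ) : ℝ := tail4 p 1

/-- The function `ψ_{1,1}` of the critical case. -/
noncomputable def psiCritical (p : ℕ → ℝ) (x : ℝ) : ℝ :=
  tail4 p x ^ 2 / (moment2 p ^ 2 * tail3 p x) - tail5 p x / moment2 p ^ 2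

/-- The explicit generating function of the limit sequence. -/
noncomputable def limitGF (p : ℕ → ℝ) (s : ℝ) : ℝ :=
  1 / moment2 p ^ 2 * (s / (1 - s))
    + moment3 p / moment2 p ^ 3 * Real.log (1 / (1 - s))
    + 1 / moment2 p * ∫ x in (0 : ℝ)..s, psiCritical p x

/-! Write φ_s(t) for the generating function of Z_t at s. At the death of the ancestor the process
restarts independently from each child, which gives the backward equation φ' = f(φ) - φ with φ(0) =
s (`popGF_eq_lintegral`, `IsBranchingMechanism.exists_backward_solution`). The equation is
autonomous. With T(s) = ∫₀ˢ dx / (f(x) - x), which is `flowTime`, the trajectory from s is therefore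
the trajectory from 0 advanced by the time c = T(s) (`flow_eq_shift`).

Criticality gives f(x) - x = (1 - x)² f₃(x), so A = 1 / (1 - φ₀) has derivative f₃(φ₀), which tends
to m₂. Hence A(t + c) - A(t) → c m₂ and A(t) / t → m₂. Since φ_s(t) - φ₀(t) = (A(t + c) - A(t)) /
(A(t) A(t + c)), it follows that t² (φ_s(t) - φ₀(t)) → T(s) / m₂ (`tendsto_sq_mul_flow_sub`). As
φ₀(t) = P(Z_t = 0), the difference is the generating function of the probabilities with k ≥ 1.

This limit is the stated one: ψ₁,₁ is 1 / (f(x) - x) minus its singular part at 1, and the integral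
of that part supplies the rational and logarithmic terms (`psiCritical_eq`, `limitGF_eq`).
Convergence passes to coefficients by `tendsto_coeff_of_tendsto_powerSeries`. Asymptotic equivalence
also needs h_k ≠ 0. This holds because p₀ / (f(x) - x) generates the partial sums of a renewal
sequence, all at least 1 (`hasSum_renewalSum`). -/

/-! ### Marked trees and the weight s ^ n -/

/-- Marks of a potential particle: its life length and its number of children. -/
abbrev Marks : Type := ℝ × ℕ

/-- A marked Ulam-Harris tree. -/
abbrev MarkedTree : Type := List ℕ → Marks

/-- The number of particles of a marked tree which are alive at time `t`. -/
noncomputable def aliveCount (t : ℝ) (a : MarkedTree) : ℕ∞ :=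
  populationSize (fun u => (a u).1) (fun u => (a u).2) t

/-- The tree with root mark `q.1` and with subtrees `q.2 i` at the children of the root. -/
def graft (q : Marks × (ℕ → MarkedTree)) : MarkedTree
  | [] => q.1
  | i :: v => q.2 i v

/-- The weight `s ^ n`, with `s ^ ∞ = 0`. -/
noncomputable def powWeight (s : ENNReal) (n : ℕ∞) : ENNReal :=
  if n = ⊤ then 0 else s ^ n.toNat

lemma powWeight_natCast (s : ENNReal) (n : ℕ) : powWeight s n = s ^ n := by
  simp [powWeight]

lemma powWeight_zero (s : ENNReal) : powWeight s 0 = 1 := by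
  simp [powWeight]

lemma powWeight_one (s : ENNReal) : powWeight s 1 = s := by
  simp [powWeight]

lemma powWeight_add (s : ENNReal) (m n : ℕ∞) :
    powWeight s (m + n) = powWeight s m * powWeight s n := by
  induction m using ENat.recTopCoe with
  | top => simp [powWeight]
  | coe m =>
    induction n using ENat.recTopCoe with
    | top => simp [powWeight]
    | coe n =>
      rw [← Nat.cast_add, powWeight_natCast, powWeight_natCast, powWeight_natCast, pow_add]

lemma powWeight_sum (s : ENNReal) {ι : Type*} (I : Finset ι) (f : ι → ℕ∞) :
    powWeight s (∑ i ∈ I, f i) = ∏ i ∈ I, powWeight s (f i) := by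
  classical
  induction I using Finset.induction_on with
  | empty => simp [powWeight_zero]
  | insert a I ha ih => rw [Finset.sum_insert ha, Finset.prod_insert ha, powWeight_add, ih]

lemma powWeight_le_one {s : ENNReal} (hs : s ≤ 1) (n : ℕ∞) : powWeight s n ≤ 1 := by
  unfold powWeight
  split_ifs
  · exact zero_le_one
  · exact pow_le_one₀ (zero_le) hs

/-- Since an infinite population has weight 0, the expected weight is the generating function of the
finite sizes, and non-explosion never has to be proved. -/
lemma powWeight_eq_tsum (s : ENNReal) (n : ℕ∞) :
    powWeight s n = ∑' k : ℕ, if n = k then s ^ k else 0 := by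
  induction n using ENat.recTopCoe with
  | top => simp [powWeight]
  | coe n =>
    rw [powWeight_natCast, tsum_eq_single n]
    · simp
    · intro k hk
      rw [if_neg]
      exact_mod_cast hk.symm

/-! ### Branching decomposition of the population size -/

lemma birthTime_nonneg (L : List ℕ → ℝ) (hL : ∀ u, 0 ≤ L u) (u : List ℕ) : 0 ≤ birthTime L u := by
  induction u generalizing L with
  | nil => exact le_rfl
  | cons i v ih => exact add_nonneg (hL _) (ih _ fun w => hL _)

lemma aliveCount_graft_of_lt {t : ℝ} {x : Marks} {b : ℕ → MarkedTree} (ht : 0 ≤ t)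
    (hb : ∀ i v, 0 ≤ (b i v).1) (htx : t < x.1) : aliveCount t (graft (x, b)) = 1 := by
  unfold aliveCount populationSize
  rw [Set.encard_eq_one]
  refine ⟨[], ?_⟩
  ext u
  cases u with
  | nil => simp [isBorn, birthTime, graft, ht, htx]
  | cons i v =>
    -- Nonnegative life lengths keep all descendants from being born before the root dies, which is
    -- after `t`.
    have := birthTime_nonneg (fun w => (b i w).1) (hb i) v
    simp only [birthTime, graft, Set.mem_ofPred_eq, Set.mem_singleton_iff, reduceCtorEq, iff_false]
    rintro ⟨-, h, -⟩
    linarith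

/-- The dead root drops out. Every other particle alive at `t` descends from exactly one child `i <
x.2`, so the alive set is a disjoint union of images, under `List.cons i`, of alive sets with clock
reset to `t - x.1`. -/
lemma aliveCount_graft_of_le {t : ℝ} {x : Marks} {b : ℕ → MarkedTree} (htx : x.1 ≤ t) :
    aliveCount t (graft (x, b)) = ∑ i ∈ Finset.range x.2, aliveCount (t - x.1) (b i) := by
  have key : {u : List ℕ | isBorn (fun u => (graft (x, b) u).2) u ∧
      birthTime (fun u => (graft (x, b) u).1) u ≤ t ∧
      t < birthTime (fun u => (graft (x, b) u).1) u + (graft (x, b) u).1} =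
      ⋃ i ∈ (Finset.range x.2 : Set ℕ), (List.cons i) '' {v : List ℕ | isBorn (fun u => (b i u).2) v ∧
        birthTime (fun u => (b i u).1) v ≤ t - x.1 ∧
        t - x.1 < birthTime (fun u => (b i u).1) v + (b i v).1} := by
    ext u
    cases u with
    | nil => simp [isBorn, birthTime, graft, htx]
    | cons i v =>
      simp only [isBorn, birthTime, graft, Set.mem_ofPred_eq, Set.mem_iUnion, Set.mem_image,
        List.cons.injEq, Finset.coe_range, Set.mem_Iio]
      constructor
      · rintro ⟨⟨h1, h2⟩, h3, h4⟩
        exact ⟨i, h1, v, ⟨h2, by linarith, by linarith⟩, rfl, rfl⟩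
      · rintro ⟨i', h1, v', ⟨h2, h3, h4⟩, rfl, rfl⟩
        exact ⟨⟨h1, h2⟩, by linarith, by linarith⟩
  unfold aliveCount populationSize
  rw [key, Set.Finite.encard_biUnion (Finset.finite_toSet _), finsum_mem_coe_finset]
  · exact Finset.sum_congr rfl fun i _ => (List.cons_injective).encard_image _
  · intro i _ j _ hij
    rw [Function.onFun, Set.disjoint_left]
    rintro _ ⟨v, _, rfl⟩ ⟨w, _, h⟩
    exact hij (List.cons.inj h).1.symm

/-! ### Measurability -/

lemma measurableSet_isBorn (u : List ℕ) :
    MeasurableSet {a : MarkedTree | isBorn (fun w => (a w).2) u} := by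
  induction u with
  | nil => simp [isBorn]
  | cons i v ih =>
    have h1 : MeasurableSet {a : MarkedTree | i < (a []).2} :=
      measurableSet_lt measurable_const (by fun_prop)
    have h2 : Measurable (fun (a : MarkedTree) (w : List ℕ) => a (i :: w)) := by fun_prop
    exact h1.inter (h2 ih)

lemma measurable_birthTime (u : List ℕ) :
    Measurable fun a : MarkedTree => birthTime (fun w => (a w).1) u := by
  induction u with
  | nil => exact measurable_const
  | cons i v ih =>
    have h2 : Measurable (fun (a : MarkedTree) (w : List ℕ) => a (i :: w)) := by fun_prop
    have h1 : Measurable (fun a : MarkedTree => (a []).1) := by fun_prop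
    exact h1.add (ih.comp h2)

/-- The cardinality is a countable sum of indicators in `ENNReal`; measurability comes back to `ℕ∞`
through singletons. -/
lemma measurable_encard_setOf {α β : Type*} [MeasurableSpace α] [Countable β] {S : α → Set β}
    (hS : ∀ b, MeasurableSet {a | b ∈ S a}) : Measurable fun a => (S a).encard := by
  have h : Measurable fun a => ((S a).encard : ENNReal) := by
    have : (fun a => ((S a).encard : ENNReal)) =
        fun a => ∑' b : β, {a | b ∈ S a}.indicator (fun _ => (1 : ENNReal)) a := by
      funext a
      rw [← ENNReal.tsum_set_one, tsum_subtype (S a) (fun _ => (1 : ENNReal))]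
      rfl
    rw [this]
    exact Measurable.tsum fun b => measurable_const.indicator (hS b)
  refine measurable_to_countable' fun k => ?_
  have : (fun a => (S a).encard) ⁻¹' {k} = (fun a => ((S a).encard : ENNReal)) ⁻¹' {(k : ENNReal)} := by
    ext a
    simp
  rw [this]
  exact h (measurableSet_singleton _)

lemma measurable_aliveCount :
    Measurable fun q : ℝ × MarkedTree => aliveCount q.1 q.2 := by
  refine measurable_encard_setOf fun u => ?_
  have h1 : MeasurableSet {q : ℝ × MarkedTree | isBorn (fun w => (q.2 w).2) u} :=
    measurable_snd (α := ℝ) (measurableSet_isBorn u)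
  have h2 : Measurable fun q : ℝ × MarkedTree => birthTime (fun w => (q.2 w).1) u :=
    (measurable_birthTime u).comp measurable_snd
  have h3 : Measurable fun q : ℝ × MarkedTree => (q.2 u).1 := by fun_prop
  exact h1.inter ((measurableSet_le h2 measurable_fst).inter
    (measurableSet_lt measurable_fst (h2.add h3)))

lemma measurable_powWeight_aliveCount (s : ENNReal) :
    Measurable fun q : ℝ × MarkedTree => powWeight s (aliveCount q.1 q.2) :=
  (measurable_from_top (f := powWeight s)).comp measurable_aliveCount

lemma measurable_graft : Measurable graft := by
  refine measurable_pi_lambda _ fun u => ?_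
  cases u with
  | nil => exact measurable_fst
  | cons i v =>
    change Measurable fun q : Marks × (ℕ → MarkedTree) => q.2 i v
    fun_prop

/-! ### The law of the marked tree -/

/-- A tree with independent marks of law `θ`, given by the root mark and the marks of the subtrees,
which are independent trees of the same type. -/
lemma map_graft_infinitePi (θ : Measure Marks) [IsProbabilityMeasure θ] :
    (θ.prod (Measure.infinitePi fun _ : ℕ => Measure.infinitePi fun _ : List ℕ => θ)).map graft =
      Measure.infinitePi fun _ : List ℕ => θ := by
  classical
  refine Measure.eq_infinitePi _ fun s t ht => ?_
  rw [Measure.map_apply measurable_graft (.pi s.countable_toSet fun _ _ => ht _)]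
  -- `c` enumerates the particles other than the root, so a finite box splits into a root factor
  -- (trivial unless `[] ∈ s`) and a box over `s'` in the curried coordinates.
  set c : ℕ × List ℕ → List ℕ := fun q => q.1 :: q.2 with hc
  have hcinj : Function.Injective c := by
    rintro ⟨i, v⟩ ⟨j, w⟩ h
    simpa [hc] using h
  set s' : Finset (ℕ × List ℕ) := s.preimage c hcinj.injOn with hs'
  have hpre : graft ⁻¹' ((s : Set (List ℕ)).pi t) =
      (if [] ∈ s then t [] else Set.univ) ×ˢ
        ((MeasurableEquiv.curry ℕ (List ℕ) Marks).symm ⁻¹'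
          ((s' : Set (ℕ × List ℕ)).pi fun q => t (c q))) := by
    ext ⟨x, b⟩
    simp only [Set.mem_preimage, Set.mem_pi, Finset.mem_coe, Set.mem_prod]
    constructor
    · intro h
      refine ⟨?_, fun q hq => h _ (Finset.mem_preimage.1 hq)⟩
      split_ifs with h0
      · exact h _ h0
      · trivial
    · rintro ⟨h1, h2⟩ u hu
      cases u with
      | nil =>
        rw [if_pos hu] at h1
        exact h1
      | cons i v => exact h2 (i, v) (Finset.mem_preimage.2 hu)
  rw [hpre, Measure.prod_prod, ← Measure.map_apply (MeasurableEquiv.measurable _)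
    (.pi s'.countable_toSet fun _ _ => ht _),
    Measure.infinitePi_map_curry_symm (fun (_ : ℕ) (_ : List ℕ) => θ),
    Measure.infinitePi_pi _ fun _ _ => ht _]
  have himg : ∏ q ∈ s', θ (t (c q)) = ∏ u ∈ s.erase [], θ (t u) := by
    rw [hs', Finset.prod_preimage' c s hcinj.injOn fun u => θ (t u)]
    congr 1
    ext u
    cases u <;> simp [hc]
  rw [himg]
  split_ifs with h0
  · exact Finset.mul_prod_erase s (fun u => θ (t u)) h0
  · rw [measure_univ, one_mul, Finset.erase_eq_of_notMem h0]

/-- The law of the marked tree with independent marks of law `θ`. -/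
noncomputable abbrev treeLaw (θ : Measure Marks) [IsProbabilityMeasure θ] : Measure MarkedTree :=
  Measure.infinitePi fun _ : List ℕ => θ

/-- The generating function `E s ^ Z_t`, with `s ^ ∞ = 0`. -/
noncomputable def popGF (θ : Measure Marks) [IsProbabilityMeasure θ] (s : ENNReal) (t : ℝ) :
    ENNReal :=
  ∫⁻ a, powWeight s (aliveCount t a) ∂(treeLaw θ)

lemma measurable_popGF (θ : Measure Marks) [IsProbabilityMeasure θ] (s : ENNReal) :
    Measurable (popGF θ s) :=
  (measurable_powWeight_aliveCount s).lintegral_prod_right'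

lemma popGF_le_one (θ : Measure Marks) [IsProbabilityMeasure θ] {s : ENNReal} (hs : s ≤ 1)
    (t : ℝ) : popGF θ s t ≤ 1 := by
  calc popGF θ s t ≤ ∫⁻ _, 1 ∂(treeLaw θ) := lintegral_mono fun a => powWeight_le_one hs _
    _ = 1 := by simp

/-- The subtrees at the children are independent with the law of the whole tree, so the expected
product is a product of equal factors. -/
lemma lintegral_prod_powWeight (θ : Measure Marks) [IsProbabilityMeasure θ] (s : ENNReal) (t : ℝ)
    (I : Finset ℕ) :
    ∫⁻ b, ∏ i ∈ I, powWeight s (aliveCount t (b i))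
      ∂(Measure.infinitePi fun _ : ℕ => treeLaw θ) = popGF θ s t ^ I.card := by
  have hm : Measurable fun a : MarkedTree => powWeight s (aliveCount t a) :=
    (measurable_powWeight_aliveCount s).comp measurable_prodMk_left
  have h := lintegral_prod_eq_prod_lintegral_of_indepFun I
    (fun (i : ℕ) (b : ℕ → MarkedTree) => powWeight s (aliveCount t (b i)))
    (iIndepFun_infinitePi (P := fun _ : ℕ => treeLaw θ)
      (X := fun (_ : ℕ) a => powWeight s (aliveCount t a)) fun _ => hm)
    (fun i => hm.comp (measurable_pi_apply i))
  rw [h, ← Finset.prod_const]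
  refine Finset.prod_congr rfl fun i _ => ?_
  unfold popGF
  conv_rhs => rw [← Measure.infinitePi_map_eval (fun _ : ℕ => treeLaw θ) i]
  rw [lintegral_map hm (measurable_pi_apply i)]

/-- The decomposition of the generating function at the death of the ancestor. -/
lemma popGF_eq_lintegral (θ : Measure Marks) [IsProbabilityMeasure θ]
    (hθ : ∀ᵐ x ∂θ, 0 ≤ x.1) (s : ENNReal) {t : ℝ} (ht : 0 ≤ t) :
    popGF θ s t = ∫⁻ x, (if t < x.1 then s else popGF θ s (t - x.1) ^ x.2) ∂θ := by
  have hm : Measurable fun a : MarkedTree => powWeight s (aliveCount t a) :=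
    (measurable_powWeight_aliveCount s).comp measurable_prodMk_left
  have hae : ∀ᵐ b ∂(Measure.infinitePi fun _ : ℕ => treeLaw θ), ∀ i v, 0 ≤ (b i v).1 := by
    refine ae_all_iff.2 fun i => ae_all_iff.2 fun v => ?_
    have h1 : ∀ᵐ a ∂(treeLaw θ), 0 ≤ (a v).1 :=
      (measurePreserving_eval_infinitePi (fun _ : List ℕ => θ) v).quasiMeasurePreserving.ae hθ
    exact (measurePreserving_eval_infinitePi (fun _ : ℕ => treeLaw θ) i).quasiMeasurePreserving.ae h1
  conv_lhs => rw [popGF, treeLaw, ← map_graft_infinitePi θ]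
  rw [lintegral_map hm measurable_graft, lintegral_prod (fun q => powWeight s (aliveCount t (graft q)))
      (hm.comp measurable_graft).aemeasurable]
  refine lintegral_congr fun x => ?_
  split_ifs with h
  · have : ∀ᵐ b ∂(Measure.infinitePi fun _ : ℕ => treeLaw θ),
        powWeight s (aliveCount t (graft (x, b))) = s := by
      filter_upwards [hae] with b hb
      rw [aliveCount_graft_of_lt ht hb h, powWeight_one]
    rw [lintegral_congr_ae this]
    simp
  · simp_rw [aliveCount_graft_of_le (not_lt.1 h), powWeight_sum]
    rw [lintegral_prod_powWeight, Finset.card_range]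

/-! ### The backward equation -/

/-- The generating function of a sequence. -/
noncomputable def genFun (c : ℕ → ℝ) (x : ℝ) : ℝ := ∑' k, c k * x ^ k

lemma summable_genFun {c : ℕ → ℝ} (hc0 : ∀ k, 0 ≤ c k) (hc : Summable c) {x : ℝ} (hx0 : 0 ≤ x)
    (hx1 : x ≤ 1) : Summable fun k => c k * x ^ k :=
  Summable.of_nonneg_of_le (fun k => mul_nonneg (hc0 k) (pow_nonneg hx0 k))
    (fun k => mul_le_of_le_one_right (hc0 k) (pow_le_one₀ hx0 hx1)) hc

lemma genFun_nonneg {c : ℕ → ℝ} (hc0 : ∀ k, 0 ≤ c k) {x : ℝ} (hx0 : 0 ≤ x) : 0 ≤ genFun c x :=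
  tsum_nonneg fun k => mul_nonneg (hc0 k) (pow_nonneg hx0 k)

lemma genFun_mono {c : ℕ → ℝ} (hc0 : ∀ k, 0 ≤ c k) (hc : Summable c) {x y : ℝ} (hx0 : 0 ≤ x)
    (hxy : x ≤ y) (hy1 : y ≤ 1) : genFun c x ≤ genFun c y :=
  (summable_genFun hc0 hc hx0 (hxy.trans hy1)).tsum_le_tsum
    (fun k => mul_le_mul_of_nonneg_left (pow_le_pow_left₀ hx0 hxy k) (hc0 k))
    (summable_genFun hc0 hc (hx0.trans hxy) hy1)

lemma genFun_one (c : ℕ → ℝ) : genFun c 1 = ∑' k, c k := by simp [genFun]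

lemma continuousOn_genFun {c : ℕ → ℝ} (hc0 : ∀ k, 0 ≤ c k) (hc : Summable c) :
    ContinuousOn (genFun c) (Set.Icc 0 1) := by
  refine continuousOn_tsum (fun k => by fun_prop) hc fun k x hx => ?_
  rw [norm_mul, norm_pow, Real.norm_of_nonneg (hc0 k), Real.norm_of_nonneg hx.1]
  exact mul_le_of_le_one_right (hc0 k) (pow_le_one₀ hx.1 hx.2)

lemma ofReal_genFun {c : ℕ → ℝ} (hc0 : ∀ k, 0 ≤ c k) (hc : Summable c) {x : ℝ} (hx0 : 0 ≤ x)
    (hx1 : x ≤ 1) :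
    ENNReal.ofReal (genFun c x) = ∑' k, ENNReal.ofReal (c k) * ENNReal.ofReal x ^ k := by
  rw [genFun, ENNReal.ofReal_tsum_of_nonneg (fun k => mul_nonneg (hc0 k) (pow_nonneg hx0 k))
    (summable_genFun hc0 hc hx0 hx1)]
  refine tsum_congr fun k => ?_
  rw [ENNReal.ofReal_mul (hc0 k), ENNReal.ofReal_pow hx0]

lemma expMeasure_one_eq_withDensity :
    expMeasure 1 = volume.withDensity (exponentialPDF 1) := rfl

lemma integral_expMeasure_one (k : ℝ → ℝ) :
    ∫ x, k x ∂(expMeasure 1) = ∫ x in Set.Ici 0, Real.exp (-x) * k x := by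
  rw [expMeasure_one_eq_withDensity, integral_withDensity_eq_integral_toReal_smul
    (by exact (measurable_exponentialPDFReal 1).ennreal_ofReal)
    (Eventually.of_forall fun x => by simp [exponentialPDF]),
    ← integral_indicator measurableSet_Ici]
  refine integral_congr_ae (Eventually.of_forall fun x => ?_)
  simp only [exponentialPDF_eq, one_mul, smul_eq_mul, Set.indicator_apply, Set.mem_Ici]
  split_ifs with h
  · rw [ENNReal.toReal_ofReal (Real.exp_pos _).le]
  · simp

/-- The substitution u = t - l moves `t` out of the integrand, leaving it only in the prefactor and
the upper limit, where it can be differentiated. -/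
lemma integral_expMeasure_one_ite (s : ℝ) {g : ℝ → ℝ} (hg : Measurable g) (C : ℝ)
    (hgb : ∀ u, |g u| ≤ C) {t : ℝ} (ht : 0 ≤ t) :
    ∫ l, (if t < l then s else g (t - l)) ∂(expMeasure 1) =
      Real.exp (-t) * (s + ∫ u in (0 : ℝ)..t, Real.exp u * g u) := by
  have hint : IntegrableOn (fun l => Real.exp (-l) * (if t < l then s else g (t - l)))
      (Set.Ici 0) := by
    have h1 : IntegrableOn (fun l : ℝ => Real.exp (-l)) (Set.Ici 0) := by
      rw [integrableOn_Ici_iff_integrableOn_Ioi]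
      exact integrableOn_exp_neg_Ioi 0
    refine Integrable.mul_bdd (c := max |s| C) h1 ?_ ?_
    · exact (Measurable.ite measurableSet_Ioi measurable_const (by fun_prop)).aestronglyMeasurable
    · refine Eventually.of_forall fun l => ?_
      split_ifs
      · exact le_max_left _ _
      · exact (hgb _).trans (le_max_right _ _)
  have hsplit : Set.Ici (0 : ℝ) = Set.Icc 0 t ∪ Set.Ioi t := (Set.Icc_union_Ioi_eq_Ici ht).symm
  rw [integral_expMeasure_one, hsplit, setIntegral_union _ measurableSet_Ioi
    (hint.mono_set (by rw [hsplit]; exact Set.subset_union_left))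
    (hint.mono_set (by rw [hsplit]; exact Set.subset_union_right))]
  · have e1 : ∫ l in Set.Ioi t, Real.exp (-l) * (if t < l then s else g (t - l)) =
        Real.exp (-t) * s := by
      rw [setIntegral_congr_fun (g := fun l => Real.exp (-l) * s) measurableSet_Ioi
        (fun l hl => by simp [Set.mem_Ioi.1 hl]), integral_mul_const, integral_exp_neg_Ioi]
    have e2 : ∫ l in Set.Icc 0 t, Real.exp (-l) * (if t < l then s else g (t - l)) =
        Real.exp (-t) * ∫ u in (0 : ℝ)..t, Real.exp u * g u := by
      rw [setIntegral_congr_fun (g := fun l => Real.exp (-t) * (Real.exp (t - l) * g (t - l)))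
        measurableSet_Icc (fun l hl => ?_), integral_Icc_eq_integral_Ioc,
        ← intervalIntegral.integral_of_le ht, intervalIntegral.integral_const_mul,
        intervalIntegral.integral_comp_sub_left (fun u => Real.exp u * g u)]
      · simp
      · simp only [not_lt.2 hl.2, if_false]
        rw [← mul_assoc, ← Real.exp_add]
        congr 2
        ring
    rw [e1, e2]
    ring
  · exact Set.disjoint_left.2 fun x hx hx' => (not_lt.2 hx.2) hx'

/-! ### The tree of a branching mechanism and its integral equation -/

lemma IsBranchingMechanism.measurable_tree {Ω : Type*} [MeasurableSpace Ω] {μ : Measure Ω}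
    {p : ℕ → ℝ} {L : List ℕ → Ω → ℝ} {X : List ℕ → Ω → ℕ} (h : IsBranchingMechanism μ p L X) :
    Measurable fun ω u => (L u ω, X u ω) :=
  measurable_pi_lambda _ fun u => (h.measurable_life u).prodMk (h.measurable_offspring u)

section

variable {Ω : Type*} [MeasurableSpace Ω] {μ : Measure Ω} [IsProbabilityMeasure μ] {p : ℕ → ℝ}
  {L : List ℕ → Ω → ℝ} {X : List ℕ → Ω → ℕ}

/-- The probability of population size `k` at time `t`. -/
noncomputable def sizeProb (μ : Measure Ω) (L : List ℕ → Ω → ℝ) (X : List ℕ → Ω → ℕ) (t : ℝ)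
    (k : ℕ) : ℝ :=
  μ.real {ω | populationSize (fun u => L u ω) (fun u => X u ω) t = (k : ℕ∞)}

/-- The law of the marks of a particle. -/
noncomputable def markLaw (μ : Measure Ω) (X : List ℕ → Ω → ℕ) : Measure Marks :=
  (expMeasure 1).prod (μ.map (X []))

lemma IsBranchingMechanism.map_offspring_singleton (h : IsBranchingMechanism μ p L X)
    (u : List ℕ) (k : ℕ) : μ.map (X u) {k} = ENNReal.ofReal (p k) := by
  rw [Measure.map_apply (h.measurable_offspring u) (measurableSet_singleton k), ← h.offspring_law u,
    ofReal_measureReal]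
  rfl

lemma IsBranchingMechanism.isProbabilityMeasure_markLaw (h : IsBranchingMechanism μ p L X) :
    IsProbabilityMeasure (markLaw μ X) := by
  have := isProbabilityMeasure_expMeasure one_pos
  have := Measure.isProbabilityMeasure_map (μ := μ) (h.measurable_offspring []).aemeasurable
  unfold markLaw
  infer_instance

lemma IsBranchingMechanism.map_eq_treeLaw (h : IsBranchingMechanism μ p L X)
    [IsProbabilityMeasure (markLaw μ X)] :
    μ.map (fun ω u => (L u ω, X u ω)) = treeLaw (markLaw μ X) := by
  have hlaw : ∀ u, μ.map (fun ω => (L u ω, X u ω)) = markLaw μ X := by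
    intro u
    rw [(indepFun_iff_map_prod_eq_prod_map_map (h.measurable_life u).aemeasurable
      (h.measurable_offspring u).aemeasurable).1 (h.indep_life_offspring u), h.life_law u, markLaw]
    congr 1
    refine Measure.ext_of_singleton fun k => ?_
    rw [h.map_offspring_singleton, h.map_offspring_singleton]
  rw [h.indep_particles.map_fun_eq_infinitePi_map
    fun u => (h.measurable_life u).prodMk (h.measurable_offspring u)]
  simp_rw [hlaw]

lemma IsBranchingMechanism.ae_markLaw_nonneg (h : IsBranchingMechanism μ p L X) :
    ∀ᵐ x ∂(markLaw μ X), 0 ≤ x.1 := by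
  have := isProbabilityMeasure_expMeasure one_pos
  have := Measure.isProbabilityMeasure_map (μ := μ) (h.measurable_offspring []).aemeasurable
  have h1 : ∀ᵐ l ∂(expMeasure 1), 0 ≤ l := by
    rw [expMeasure_one_eq_withDensity, ae_withDensity_iff
      (by exact (measurable_exponentialPDFReal 1).ennreal_ofReal)]
    refine Eventually.of_forall fun l hl => ?_
    by_contra hneg
    exact hl (exponentialPDF_of_neg (not_le.1 hneg))
  exact (Measure.quasiMeasurePreserving_fst (μ := expMeasure 1) (ν := μ.map (X []))).ae h1

lemma IsBranchingMechanism.hasSum_sizeProb (h : IsBranchingMechanism μ p L X)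
    [IsProbabilityMeasure (markLaw μ X)] {s : ℝ} (hs0 : 0 ≤ s) (hs1 : s ≤ 1) (t : ℝ) :
    HasSum (fun k => sizeProb μ L X t k * s ^ k)
      (popGF (markLaw μ X) (ENNReal.ofReal s) t).toReal := by
  have hm : Measurable fun a : MarkedTree => powWeight (ENNReal.ofReal s) (aliveCount t a) :=
    (measurable_powWeight_aliveCount _).comp measurable_prodMk_left
  have hc : Measurable fun ω => aliveCount t (fun u => (L u ω, X u ω)) :=
    (measurable_aliveCount.comp measurable_prodMk_left).comp h.measurable_tree
  have hms : ∀ k : ℕ, MeasurableSet {ω | aliveCount t (fun u => (L u ω, X u ω)) = (k : ℕ∞)} :=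
    fun k => hc (measurableSet_singleton _)
  have e : popGF (markLaw μ X) (ENNReal.ofReal s) t =
      ∑' k : ℕ, ENNReal.ofReal (sizeProb μ L X t k * s ^ k) := by
    rw [popGF, ← h.map_eq_treeLaw, lintegral_map hm h.measurable_tree]
    simp_rw [powWeight_eq_tsum]
    rw [lintegral_tsum fun k => (Measurable.ite (hms k) measurable_const
      measurable_const).aemeasurable]
    refine tsum_congr fun k => ?_
    have : (fun ω => if aliveCount t (fun u => (L u ω, X u ω)) = (k : ℕ∞)
        then ENNReal.ofReal s ^ k else 0) =
        {ω | aliveCount t (fun u => (L u ω, X u ω)) = (k : ℕ∞)}.indicator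
          (fun _ => ENNReal.ofReal s ^ k) := by
      funext ω
      simp [Set.indicator_apply]
    rw [this, lintegral_indicator_const (hms k), sizeProb, ENNReal.ofReal_mul measureReal_nonneg,
      ofReal_measureReal, ENNReal.ofReal_pow hs0, mul_comm]
    rfl
  have hfin : popGF (markLaw μ X) (ENNReal.ofReal s) t ≠ ⊤ :=
    ((popGF_le_one _ (ENNReal.ofReal_le_one.2 hs1) t).trans_lt ENNReal.one_lt_top).ne
  rw [e] at hfin ⊢
  have hs := ENNReal.hasSum_toReal hfin
  rw [ENNReal.tsum_toReal_eq (fun k => ENNReal.ofReal_ne_top)]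
  have hn : ∀ k, 0 ≤ sizeProb μ L X t k * s ^ k :=
    fun k => mul_nonneg measureReal_nonneg (pow_nonneg hs0 k)
  simpa only [ENNReal.toReal_ofReal (hn _)] using hs

/-- Averaging the decomposition at the ancestor's death over the offspring number produces `genFun
p`; averaging over the exponential life length produces the integral. -/
lemma IsBranchingMechanism.popGF_integral_equation (h : IsBranchingMechanism μ p L X)
    [IsProbabilityMeasure (markLaw μ X)] (hp0 : ∀ k, 0 ≤ p k) (hp : HasSum p 1)
    {s : ℝ} (hs0 : 0 ≤ s) (hs1 : s ≤ 1) :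
    (Measurable fun u => genFun p (popGF (markLaw μ X) (ENNReal.ofReal s) u).toReal) ∧
    ∀ t, 0 ≤ t → (popGF (markLaw μ X) (ENNReal.ofReal s) t).toReal =
      Real.exp (-t) * (s + ∫ u in (0 : ℝ)..t,
        Real.exp u * genFun p (popGF (markLaw μ X) (ENNReal.ofReal s) u).toReal) := by
  have := isProbabilityMeasure_expMeasure one_pos
  have := Measure.isProbabilityMeasure_map (μ := μ) (h.measurable_offspring []).aemeasurable
  set Φ : ℝ → ENNReal := popGF (markLaw μ X) (ENNReal.ofReal s) with hΦ
  have hΦm : Measurable Φ := measurable_popGF _ _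
  have hΦ1 : ∀ t, Φ t ≤ 1 := popGF_le_one _ (ENNReal.ofReal_le_one.2 hs1)
  have hΦt : ∀ t, Φ t ≠ ⊤ := fun t => ((hΦ1 t).trans_lt ENNReal.one_lt_top).ne
  have hφ1 : ∀ t, (Φ t).toReal ≤ 1 := fun t => ENNReal.toReal_le_of_le_ofReal zero_le_one
    (by simpa using hΦ1 t)
  set g : ℝ → ℝ := fun u => genFun p (Φ u).toReal with hgdef
  have hg0 : ∀ u, 0 ≤ g u := fun u => genFun_nonneg hp0 ENNReal.toReal_nonneg
  have hg1 : ∀ u, g u ≤ 1 := fun u => by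
    have := genFun_mono hp0 hp.summable ENNReal.toReal_nonneg (hφ1 u) le_rfl
    rwa [genFun_one, hp.tsum_eq] at this
  have hgΦ : ∀ u, ENNReal.ofReal (g u) = ∑' k, ENNReal.ofReal (p k) * Φ u ^ k := fun u => by
    rw [hgdef]
    simp only
    rw [ofReal_genFun hp0 hp.summable ENNReal.toReal_nonneg (hφ1 u),
      ENNReal.ofReal_toReal (hΦt u)]
  -- The `ENNReal` series for `g` is a sum of measurable functions, so no regularity in time is
  -- needed yet.
  have hgm : Measurable g := by
    have : g = fun u => (∑' k, ENNReal.ofReal (p k) * Φ u ^ k).toReal := by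
      funext u
      rw [← hgΦ, ENNReal.toReal_ofReal (hg0 u)]
    rw [this]
    exact (Measurable.tsum fun k => (hΦm.pow_const k).const_mul _).ennreal_toReal
  refine ⟨hgm, fun t ht => ?_⟩
  have hkm : Measurable fun l => if t < l then s else g (t - l) :=
    Measurable.ite measurableSet_Ioi measurable_const (by fun_prop)
  rw [← integral_expMeasure_one_ite s hgm 1 (fun u => by rw [abs_of_nonneg (hg0 u)]; exact hg1 u) ht,
    integral_eq_lintegral_of_nonneg_ae (Eventually.of_forall fun l => ?_)
      hkm.aestronglyMeasurable]
  · congr 1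
    rw [hΦ, popGF_eq_lintegral _ h.ae_markLaw_nonneg _ ht, ← hΦ, markLaw, lintegral_prod]
    · refine lintegral_congr fun l => ?_
      split_ifs with hl
      · simp
      · rw [hgΦ, lintegral_countable']
        exact tsum_congr fun k => by rw [h.map_offspring_singleton, mul_comm]
    · refine Measurable.aemeasurable ?_
      refine Measurable.ite (measurableSet_lt measurable_const measurable_fst) measurable_const ?_
      exact (hΦm.comp (measurable_const.sub measurable_fst)).pow measurable_snd
  · change 0 ≤ if t < l then s else g (t - l)
    split_ifs
    exacts [hs0, hg0 _]

/-- The generating function of the population size solves the backward equation. -/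
theorem IsBranchingMechanism.exists_backward_solution (h : IsBranchingMechanism μ p L X)
    (hp0 : ∀ k, 0 ≤ p k) (hp : HasSum p 1) {s : ℝ} (hs : s ∈ Set.Ico (0 : ℝ) 1) :
    ∃ φ : ℝ → ℝ, (∀ t, HasSum (fun k => sizeProb μ L X t k * s ^ k) (φ t)) ∧ φ 0 = s ∧
      ContinuousOn φ (Set.Ici 0) ∧ (∀ t, 0 ≤ t → φ t ∈ Set.Ico (0 : ℝ) 1) ∧
      ∀ t, 0 < t → HasDerivAt φ (genFun p (φ t) - φ t) t := by
  have := h.isProbabilityMeasure_markLaw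
  obtain ⟨hgm, heq⟩ := h.popGF_integral_equation hp0 hp hs.1 hs.2.le
  set φ : ℝ → ℝ := fun t => (popGF (markLaw μ X) (ENNReal.ofReal s) t).toReal with hφ
  have hφ0 : ∀ t, 0 ≤ φ t := fun t => ENNReal.toReal_nonneg
  have hφ1 : ∀ t, φ t ≤ 1 := fun t => ENNReal.toReal_le_of_le_ofReal zero_le_one
    (by simpa using popGF_le_one _ (ENNReal.ofReal_le_one.2 hs.2.le) t)
  set g : ℝ → ℝ := fun u => genFun p (φ u) with hg
  have hg0 : ∀ u, 0 ≤ g u := fun u => genFun_nonneg hp0 (hφ0 u)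
  have hg1 : ∀ u, g u ≤ 1 := fun u => by
    have := genFun_mono hp0 hp.summable (hφ0 u) (hφ1 u) le_rfl
    rwa [genFun_one, hp.tsum_eq] at this
  have hii : ∀ a b, IntervalIntegrable (fun u => Real.exp u * g u) volume a b := by
    intro a b
    refine (Real.continuous_exp.intervalIntegrable a b).mono_fun
      ((Real.measurable_exp.mul hgm).aestronglyMeasurable) (Eventually.of_forall fun u => ?_)
    simp only [norm_mul, Real.norm_of_nonneg (hg0 u)]
    exact mul_le_of_le_one_right (norm_nonneg _) (hg1 u)
  set J : ℝ → ℝ := fun t => ∫ u in (0 : ℝ)..t, Real.exp u * g u with hJ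
  have heq' : ∀ t, 0 ≤ t → φ t = Real.exp (-t) * (s + J t) := heq
  -- Regularity is bootstrapped: bounded measurable `g` makes `J` continuous, hence `φ` and then `g`
  -- are continuous, hence `J` is differentiable at positive times.
  have hJc : Continuous J := intervalIntegral.continuous_primitive hii 0
  have hcont : ContinuousOn φ (Set.Ici 0) := by
    refine ContinuousOn.congr (f := fun t => Real.exp (-t) * (s + J t)) ?_ fun t ht => heq' t ht
    fun_prop
  refine ⟨φ, h.hasSum_sizeProb hs.1 hs.2.le, ?_, hcont, fun t ht => ⟨hφ0 t, ?_⟩, fun t ht => ?_⟩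
  · rw [heq' 0 le_rfl]
    simp [hJ]
  -- With s < 1 this gives s + J t < exp t, which is the strict bound φ t < 1.
  · have hJle : J t ≤ Real.exp t - 1 := by
      have : J t ≤ ∫ u in (0 : ℝ)..t, Real.exp u :=
        intervalIntegral.integral_mono_on ht (hii 0 t) (Real.continuous_exp.intervalIntegrable 0 t)
          fun u _ => mul_le_of_le_one_right (Real.exp_pos u).le (hg1 u)
      simpa using this
    rw [heq' t ht, Real.exp_neg, inv_mul_lt_one₀ (Real.exp_pos t)]
    linarith [hs.2]
  · have hca : ContinuousAt φ t := hcont.continuousAt (Ici_mem_nhds ht)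
    have hgc : ContinuousAt g t := by
      have h1 : ContinuousOn g (Set.Ici 0) :=
        (continuousOn_genFun hp0 hp.summable).comp hcont fun u _ => ⟨hφ0 u, hφ1 u⟩
      exact h1.continuousAt (Ici_mem_nhds ht)
    have hJd : HasDerivAt J (Real.exp t * g t) t :=
      intervalIntegral.integral_hasDerivAt_right (hii 0 t)
        ((Real.measurable_exp.mul hgm).stronglyMeasurable.stronglyMeasurableAtFilter)
        (Real.continuous_exp.continuousAt.mul hgc)
    have hd : HasDerivAt (fun t => Real.exp (-t) * (s + J t)) (g t - φ t) t := by
      have := (hasDerivAt_neg t).exp.mul (hJd.const_add s)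
      convert! this using 1
      rw [heq' t ht.le, mul_neg_one, neg_mul, ← mul_assoc, ← Real.exp_add, neg_add_cancel,
        Real.exp_zero, one_mul]
      ring
    exact hd.congr_of_eventuallyEq (by
      filter_upwards [Ioi_mem_nhds ht] with u hu using heq' u (le_of_lt hu))

end

/-! ### Tail sums -/

/-- The tail sums of a sequence. -/
noncomputable def tailSum (c : ℕ → ℝ) (m : ℕ) : ℝ := ∑' i, c (i + m + 1)

lemma tailSum_nonneg {c : ℕ → ℝ} (hc0 : ∀ k, 0 ≤ c k) (m : ℕ) : 0 ≤ tailSum c m :=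
  tsum_nonneg fun _ => hc0 _

lemma summable_tail {c : ℕ → ℝ} (hc : Summable c) (m : ℕ) : Summable fun i => c (i + m + 1) :=
  (summable_nat_add_iff (m + 1)).2 hc

lemma tailSum_succ {c : ℕ → ℝ} (hc : Summable c) (m : ℕ) :
    tailSum c m = c (m + 1) + tailSum c (m + 1) := by
  rw [tailSum, (summable_tail hc m).tsum_eq_zero_add, tailSum]
  congr 1
  · simp
  · exact tsum_congr fun i => by congr 1; ring

lemma tailSum_zero {c : ℕ → ℝ} (hc : Summable c) : ∑' k, c k = c 0 + tailSum c 0 := by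
  rw [hc.tsum_eq_zero_add, tailSum]

lemma tailSum_le {c : ℕ → ℝ} (hc0 : ∀ k, 0 ≤ c k) (hc : Summable c) (m : ℕ) :
    tailSum c m ≤ ∑' k, c k := by
  induction m with
  | zero => rw [tailSum_zero hc]; linarith [hc0 0]
  | succ m ih => linarith [tailSum_succ hc m, hc0 (m + 1)]

lemma summable_mul_pow_of_le {c : ℕ → ℝ} {C : ℝ} (hc : ∀ k, |c k| ≤ C) {x : ℝ} (hx0 : 0 ≤ x)
    (hx1 : x < 1) : Summable fun k => c k * x ^ k := by
  refine Summable.of_norm_bounded ((summable_geometric_of_lt_one hx0 hx1).mul_left C) fun k => ?_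
  rw [norm_mul, norm_pow, Real.norm_of_nonneg hx0]
  exact mul_le_mul_of_nonneg_right (hc k) (pow_nonneg hx0 k)

/-- Summation by parts from `tailSum_succ`. Only boundedness of the tail sums is used, not their
summability, so with third moments the identity still reaches the fourth iterate, that is `tail5`.
-/
lemma genFun_tailSum {c : ℕ → ℝ} (hc0 : ∀ k, 0 ≤ c k) (hc : Summable c) {x : ℝ} (hx0 : 0 ≤ x)
    (hx1 : x < 1) : (1 - x) * genFun (tailSum c) x = genFun c 1 - genFun c x := by
  have hT : Summable fun k => tailSum c k * x ^ k :=
    summable_mul_pow_of_le (C := ∑' k, c k)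
      (fun k => by rw [abs_of_nonneg (tailSum_nonneg hc0 k)]; exact tailSum_le hc0 hc k) hx0 hx1
  have hC := summable_genFun hc0 hc hx0 hx1.le
  have hT' : Summable fun k => tailSum c (k + 1) * x ^ (k + 1) :=
    (summable_nat_add_iff (f := fun k => tailSum c k * x ^ k) 1).2 hT
  have hC' : Summable fun k => c (k + 1) * x ^ (k + 1) :=
    (summable_nat_add_iff (f := fun k => c k * x ^ k) 1).2 hC
  have e1 : genFun (tailSum c) x = tailSum c 0 + ∑' k, tailSum c (k + 1) * x ^ (k + 1) := by
    rw [genFun, hT.tsum_eq_zero_add]; simp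
  have e2 : genFun c x = c 0 + ∑' k, c (k + 1) * x ^ (k + 1) := by
    rw [genFun, hC.tsum_eq_zero_add]; simp
  have e3 : x * genFun (tailSum c) x =
      ∑' k, c (k + 1) * x ^ (k + 1) + ∑' k, tailSum c (k + 1) * x ^ (k + 1) := by
    rw [← hC'.tsum_add hT', genFun, ← tsum_mul_left]
    exact tsum_congr fun k => by rw [tailSum_succ hc k]; ring
  rw [sub_mul, one_mul, e3, e2, e1, genFun_one, tailSum_zero hc]
  ring

lemma summable_and_tsum_eq_of_antidiagonal {F : ℕ → ℕ → ℝ} (hF : ∀ m i, 0 ≤ F m i)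
    (hs : Summable fun n => ∑ q ∈ Finset.HasAntidiagonal.antidiagonal n, F q.1 q.2) :
    Summable (fun m => ∑' i, F m i) ∧
      ∑' m, ∑' i, F m i = ∑' n, ∑ q ∈ Finset.HasAntidiagonal.antidiagonal n, F q.1 q.2 := by
  have hS : Summable fun q : (Σ n : ℕ, Finset.HasAntidiagonal.antidiagonal n) =>
      F (Finset.HasAntidiagonal.sigmaAntidiagonalEquivProd q).1 (Finset.HasAntidiagonal.sigmaAntidiagonalEquivProd q).2 := by
    rw [summable_sigma_of_nonneg fun _ => hF _ _]
    refine ⟨fun n => Summable.of_finite, ?_⟩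
    refine hs.congr fun n => ?_
    rw [tsum_fintype, Finset.univ_eq_attach,
      ← Finset.sum_attach _ fun q : ℕ × ℕ => F q.1 q.2]
    rfl
  have hP : Summable fun q : ℕ × ℕ => F q.1 q.2 :=
    (Finset.HasAntidiagonal.sigmaAntidiagonalEquivProd.summable_iff (f := fun q : ℕ × ℕ => F q.1 q.2)).1 hS
  refine ⟨((summable_prod_of_nonneg fun _ => hF _ _).1 hP).2, ?_⟩
  rw [← hP.tsum_prod, ← Finset.HasAntidiagonal.sigmaAntidiagonalEquivProd.tsum_eq, hS.tsum_sigma]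
  refine tsum_congr fun n => ?_
  rw [tsum_fintype, Finset.univ_eq_attach, ← Finset.sum_attach _ fun q : ℕ × ℕ => F q.1 q.2]
  rfl

/-- The term c (n + 1) occurs in n + 1 tail sums with weights at most (n + 1) ^ j, so each passage
to tails costs one moment. -/
lemma summable_pow_mul_tailSum {c : ℕ → ℝ} (hc0 : ∀ k, 0 ≤ c k) (j : ℕ)
    (hc : Summable fun k : ℕ => (k : ℝ) ^ (j + 1) * c k) :
    Summable fun k : ℕ => (k : ℝ) ^ j * tailSum c k := by
  have h := (summable_and_tsum_eq_of_antidiagonal (F := fun m i => (m : ℝ) ^ j * c (i + m + 1))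
    (fun m i => mul_nonneg (by positivity) (hc0 _)) ?_).1
  · simpa only [tailSum, tsum_mul_left] using h
  · refine Summable.of_nonneg_of_le
      (fun n => Finset.sum_nonneg fun q _ => mul_nonneg (by positivity) (hc0 _)) (fun n => ?_)
      ((summable_nat_add_iff (f := fun k : ℕ => (k : ℝ) ^ (j + 1) * c k) 1).2 hc)
    calc ∑ q ∈ Finset.HasAntidiagonal.antidiagonal n, (q.1 : ℝ) ^ j * c (q.2 + q.1 + 1)
        ≤ ∑ q ∈ Finset.HasAntidiagonal.antidiagonal n, ((n + 1 : ℕ) : ℝ) ^ j * c (n + 1) := by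
          refine Finset.sum_le_sum fun q hq => ?_
          have hq' := Finset.HasAntidiagonal.mem_antidiagonal.1 hq
          rw [show q.2 + q.1 + 1 = n + 1 by omega]
          refine mul_le_mul_of_nonneg_right (pow_le_pow_left₀ (by positivity) ?_ j) (hc0 _)
          exact_mod_cast (by omega : q.1 ≤ n + 1)
      _ = ((n + 1 : ℕ) : ℝ) ^ (j + 1) * c (n + 1) := by
          rw [Finset.sum_const, Finset.Nat.card_antidiagonal, nsmul_eq_mul, pow_succ]
          ring

/-- Each c k lies in exactly `k` of the tail sums. -/
lemma tsum_tailSum {c : ℕ → ℝ} (hc0 : ∀ k, 0 ≤ c k) (hc : Summable fun k : ℕ => (k : ℝ) * c k) :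
    ∑' m, tailSum c m = ∑' k : ℕ, (k : ℝ) * c k := by
  have e : ∀ n : ℕ, ∑ q ∈ Finset.HasAntidiagonal.antidiagonal n, c (q.2 + q.1 + 1) =
      ((n + 1 : ℕ) : ℝ) * c (n + 1) := by
    intro n
    rw [Finset.sum_congr rfl (g := fun _ => c (n + 1)) fun q hq => ?_, Finset.sum_const,
      Finset.Nat.card_antidiagonal, nsmul_eq_mul]
    have hq' := Finset.HasAntidiagonal.mem_antidiagonal.1 hq
    rw [show q.2 + q.1 + 1 = n + 1 by omega]
  have h := (summable_and_tsum_eq_of_antidiagonal (F := fun m i => c (i + m + 1)) (fun m i => hc0 _)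
    (by simp_rw [e]; exact (summable_nat_add_iff (f := fun k : ℕ => (k : ℝ) * c k) 1).2 hc)).2
  simp_rw [e] at h
  rw [hc.tsum_eq_zero_add]
  simpa [tailSum] using h

/-! ### Tail generating functions -/

/-- Induction summing out the first index, which turns one unit of the shift `n` into one tail sum.
In `ENNReal` the sums may be reordered freely. -/
lemma ennreal_tsum_tail (n : ℕ) (c : ℕ → ENNReal) (x : ENNReal) :
    ∑' i : Fin (n + 1) → ℕ, c (∑ j, i j + n) * x ^ i (Fin.last n) =
      ∑' m, ((fun (v : ℕ → ENNReal) m => ∑' i, v (i + m + 1))^[n] c) m * x ^ m := by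
  induction n generalizing c with
  | zero =>
    rw [← (Equiv.funUnique (Fin 1) ℕ).symm.tsum_eq]
    simp
  | succ n ih =>
    rw [Function.iterate_succ_apply, ← ih, ← (Fin.consEquiv fun _ : Fin (n + 2) => ℕ).tsum_eq,
      ENNReal.tsum_prod', ENNReal.tsum_comm]
    refine tsum_congr fun i => ?_
    rw [← ENNReal.tsum_mul_right]
    refine tsum_congr fun k => ?_
    rw [← Fin.succ_last]
    simp only [Fin.consEquiv_apply, Fin.cons_succ, Fin.sum_univ_succ (n := n + 1), Fin.cons_zero]
    congr 2
    ring

lemma ofReal_tailSum {c : ℕ → ℝ} (hc0 : ∀ k, 0 ≤ c k) (hc : Summable c) (m : ℕ) :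
    ∑' i, ENNReal.ofReal (c (i + m + 1)) = ENNReal.ofReal (tailSum c m) :=
  (ENNReal.ofReal_tsum_of_nonneg (fun _ => hc0 _) (summable_tail hc m)).symm

lemma tailSum_iterate_nonneg {c : ℕ → ℝ} (hc0 : ∀ k, 0 ≤ c k) (n m : ℕ) :
    0 ≤ (tailSum^[n] c) m := by
  induction n generalizing c with
  | zero => exact hc0 m
  | succ n ih => exact ih (tailSum_nonneg hc0)

lemma ofReal_tailSum_iterate (n : ℕ) {c : ℕ → ℝ} (hc0 : ∀ k, 0 ≤ c k)
    (hc : ∀ k < n, Summable (tailSum^[k] c)) :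
    (fun (v : ℕ → ENNReal) m => ∑' i, v (i + m + 1))^[n] (fun k => ENNReal.ofReal (c k)) =
      fun m => ENNReal.ofReal ((tailSum^[n] c) m) := by
  induction n generalizing c with
  | zero => rfl
  | succ n ih =>
    rw [Function.iterate_succ_apply, Function.iterate_succ_apply,
      ← ih (tailSum_nonneg hc0) fun k hk => hc (k + 1) (by omega)]
    congr 1
    funext m
    exact ofReal_tailSum hc0 (hc 0 (by omega)) m

lemma tailGF_eq_genFun (n : ℕ) {c : ℕ → ℝ} (hc0 : ∀ k, 0 ≤ c k)
    (hc : ∀ k < n, Summable (tailSum^[k] c)) (s : Fin (n + 1) → ℝ)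
    (hs : ∀ j : Fin n, s j.castSucc = 1) (hs0 : 0 ≤ s (Fin.last n)) :
    tailGF c (n + 1) s = genFun (tailSum^[n] c) (s (Fin.last n)) := by
  have hprod : ∀ i : Fin (n + 1) → ℕ, ∏ j, s j ^ i j = s (Fin.last n) ^ i (Fin.last n) := by
    intro i
    rw [Fin.prod_univ_castSucc]
    simp [hs]
  have h := congrArg ENNReal.toReal
    (ennreal_tsum_tail n (fun k => ENNReal.ofReal (c k)) (ENNReal.ofReal (s (Fin.last n))))
  -- Only the individual terms must be finite: a divergent series has value 0 on both sides after
  -- `toReal`, so the last iterate need not be summable.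
  rw [ofReal_tailSum_iterate n hc0 hc, ENNReal.tsum_toReal_eq fun _ => by finiteness,
    ENNReal.tsum_toReal_eq fun _ => by finiteness] at h
  simp only [ENNReal.toReal_mul, ENNReal.toReal_pow, ENNReal.toReal_ofReal hs0,
    ENNReal.toReal_ofReal (hc0 _), ENNReal.toReal_ofReal (tailSum_iterate_nonneg hc0 n _)] at h
  rw [tailGF, genFun, ← h]
  exact tsum_congr fun i => by rw [hprod]; rfl

/-! ### Critical reproduction laws -/

/-- A nondegenerate critical reproduction law with finite third moment. -/
structure IsCriticalLaw (p : ℕ → ℝ) : Prop where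
  nonneg : ∀ k, 0 ≤ p k
  hasSum : HasSum p 1
  one_ne : p 1 ≠ 1
  mean : HasSum (fun k : ℕ => (k : ℝ) * p k) 1
  third_moment : Summable fun k : ℕ => (k : ℝ) ^ 3 * p k

namespace IsCriticalLaw

variable {p : ℕ → ℝ}

lemma of_summable_log (hp_nonneg : ∀ k, 0 ≤ p k) (hp_sum : HasSum p 1) (hp_one : p 1 ≠ 1)
    (hp_mean : HasSum (fun k : ℕ => (k : ℝ) * p k) 1)
    (hp_log : Summable (fun k : ℕ => p k * (k : ℝ) ^ 3 * Real.log k)) : IsCriticalLaw p := by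
  refine ⟨hp_nonneg, hp_sum, hp_one, hp_mean, ?_⟩
  rw [← summable_nat_add_iff 3]
  refine Summable.of_nonneg_of_le (fun k => mul_nonneg (by positivity) (hp_nonneg _)) (fun k => ?_)
    ((summable_nat_add_iff 3).2 hp_log)
  have h0 : 0 ≤ p (k + 3) * ((k + 3 : ℕ) : ℝ) ^ 3 := mul_nonneg (hp_nonneg _) (by positivity)
  have h1 : 1 ≤ Real.log ((k + 3 : ℕ) : ℝ) := by
    rw [Real.le_log_iff_exp_le (by positivity)]
    have h3 : (3 : ℝ) ≤ ((k + 3 : ℕ) : ℝ) := by exact_mod_cast Nat.le_add_left 3 k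
    linarith [Real.exp_one_lt_d9]
  calc ((k + 3 : ℕ) : ℝ) ^ 3 * p (k + 3) = p (k + 3) * ((k + 3 : ℕ) : ℝ) ^ 3 * 1 := by ring
    _ ≤ _ := mul_le_mul_of_nonneg_left h1 h0

/-- If p₀ = 0, then ∑ (k - 1) p_k = 0 has nonnegative terms, which forces all mass onto k = 1. -/
lemma p_zero_pos (h : IsCriticalLaw p) : 0 < p 0 := by
  refine lt_of_le_of_ne (h.nonneg 0) fun h0 => h.one_ne ?_
  have hs : HasSum (fun k : ℕ => (k : ℝ) * p k - p k) 0 := by simpa using h.mean.sub h.hasSum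
  have hn : ∀ k : ℕ, 0 ≤ (k : ℝ) * p k - p k := by
    intro k
    rcases Nat.eq_zero_or_pos k with rfl | hk
    · simp [← h0]
    · have : (1 : ℝ) ≤ k := by exact_mod_cast hk
      nlinarith [h.nonneg k]
  have hz := (hasSum_zero_iff_of_nonneg hn).1 hs
  have hpk : ∀ k, k ≠ 1 → p k = 0 := by
    intro k hk
    rcases Nat.eq_zero_or_pos k with rfl | hk0
    · exact h0.symm
    · have hk2 : (2 : ℝ) ≤ k := by exact_mod_cast (by omega : 2 ≤ k)
      have : (k : ℝ) * p k - p k = 0 := congrFun hz k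
      nlinarith [h.nonneg k]
  exact (hasSum_single 1 hpk).unique h.hasSum

lemma summable_pow (h : IsCriticalLaw p) {j : ℕ} (hj : j ≤ 3) :
    Summable fun k : ℕ => (k : ℝ) ^ j * p k := by
  refine Summable.of_nonneg_of_le (fun k => mul_nonneg (by positivity) (h.nonneg _)) (fun k => ?_)
    (h.hasSum.summable.add h.third_moment)
  rcases Nat.eq_zero_or_pos k with rfl | hk
  · have := h.nonneg 0
    rcases Nat.eq_zero_or_pos j with rfl | hj0
    · simp
    · simp [hj0.ne', this]
  · have hk1 : (1 : ℝ) ≤ k := by exact_mod_cast hk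
    have := mul_le_mul_of_nonneg_right (pow_le_pow_right₀ hk1 hj) (h.nonneg k)
    linarith [h.nonneg k]

lemma summable_pow_tailSum_iterate (h : IsCriticalLaw p) (n j : ℕ) (hj : n + j ≤ 3) :
    Summable fun k : ℕ => (k : ℝ) ^ j * (tailSum^[n] p) k := by
  induction n generalizing j with
  | zero => exact h.summable_pow (by omega)
  | succ n ih =>
    rw [Function.iterate_succ_apply']
    exact summable_pow_mul_tailSum (tailSum_iterate_nonneg h.nonneg n) j (ih (j + 1) (by omega))

lemma summable_tailSum_iterate (h : IsCriticalLaw p) {n : ℕ} (hn : n ≤ 3) :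
    Summable (tailSum^[n] p) := by
  simpa using h.summable_pow_tailSum_iterate n 0 (by omega)

lemma tail3_eq (h : IsCriticalLaw p) {x : ℝ} (hx : 0 ≤ x) :
    tail3 p x = genFun (tailSum^[2] p) x :=
  tailGF_eq_genFun 2 h.nonneg (fun k hk => h.summable_tailSum_iterate (by omega)) ![1, 1, x]
    (fun j => by fin_cases j <;> rfl) hx

lemma tail4_eq (h : IsCriticalLaw p) {x : ℝ} (hx : 0 ≤ x) :
    tail4 p x = genFun (tailSum^[3] p) x :=
  tailGF_eq_genFun 3 h.nonneg (fun k hk => h.summable_tailSum_iterate (by omega)) ![1, 1, 1, x]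
    (fun j => by fin_cases j <;> rfl) hx

lemma tail5_eq (h : IsCriticalLaw p) {x : ℝ} (hx : 0 ≤ x) :
    tail5 p x = genFun (tailSum^[4] p) x :=
  tailGF_eq_genFun 4 h.nonneg (fun k hk => h.summable_tailSum_iterate (by omega)) ![1, 1, 1, 1, x]
    (fun j => by fin_cases j <;> rfl) hx

lemma genFun_tailSum_iterate (h : IsCriticalLaw p) {n : ℕ} (hn : n ≤ 3) {x : ℝ}
    (hx : x ∈ Set.Ico (0 : ℝ) 1) : (1 - x) * genFun (tailSum^[n + 1] p) x =
      genFun (tailSum^[n] p) 1 - genFun (tailSum^[n] p) x := by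
  rw [Function.iterate_succ_apply']
  exact genFun_tailSum (tailSum_iterate_nonneg h.nonneg n) (h.summable_tailSum_iterate hn) hx.1 hx.2

lemma genFun_one_eq (h : IsCriticalLaw p) : genFun p 1 = 1 := by
  rw [genFun_one, h.hasSum.tsum_eq]

lemma genFun_tailSum_one (h : IsCriticalLaw p) : genFun (tailSum p) 1 = 1 := by
  rw [genFun_one, tsum_tailSum h.nonneg h.mean.summable, h.mean.tsum_eq]

lemma one_sub_mul_tailSum (h : IsCriticalLaw p) {x : ℝ} (hx : x ∈ Set.Ico (0 : ℝ) 1) :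
    (1 - x) * genFun (tailSum p) x = 1 - genFun p x := by
  have := h.genFun_tailSum_iterate (n := 0) (by omega) hx
  simpa [h.genFun_one_eq] using this

/-- Two summations by parts; criticality enters as T(1) = 1 for the generating function T of
`tailSum p`. -/
lemma genFun_sub_self (h : IsCriticalLaw p) {x : ℝ} (hx : x ∈ Set.Ico (0 : ℝ) 1) :
    genFun p x - x = (1 - x) ^ 2 * tail3 p x := by
  have h1 := h.one_sub_mul_tailSum hx
  have h2 := h.genFun_tailSum_iterate (n := 1) (by omega) hx
  rw [Function.iterate_one, h.genFun_tailSum_one, one_add_one_eq_two] at h2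
  rw [h.tail3_eq hx.1, pow_two, mul_assoc, h2, mul_sub, h1]
  ring

lemma one_sub_mul_tail4 (h : IsCriticalLaw p) {x : ℝ} (hx : x ∈ Set.Ico (0 : ℝ) 1) :
    (1 - x) * tail4 p x = moment2 p - tail3 p x := by
  rw [h.tail4_eq hx.1, moment2, h.tail3_eq zero_le_one, h.tail3_eq hx.1]
  exact h.genFun_tailSum_iterate (n := 2) (by omega) hx

lemma one_sub_mul_tail5 (h : IsCriticalLaw p) {x : ℝ} (hx : x ∈ Set.Ico (0 : ℝ) 1) :
    (1 - x) * tail5 p x = moment3 p - tail4 p x := by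
  rw [h.tail5_eq hx.1, moment3, h.tail4_eq zero_le_one, h.tail4_eq hx.1]
  exact h.genFun_tailSum_iterate (n := 3) (by omega) hx

lemma tail3_mono (h : IsCriticalLaw p) {x y : ℝ} (hx : 0 ≤ x) (hxy : x ≤ y) (hy : y ≤ 1) :
    tail3 p x ≤ tail3 p y := by
  rw [h.tail3_eq hx, h.tail3_eq (hx.trans hxy)]
  exact genFun_mono (tailSum_iterate_nonneg h.nonneg 2) (h.summable_tailSum_iterate (by omega))
    hx hxy hy

/-- By monotonicity it is enough to look at 0, where the value is p₀. -/
lemma tail3_pos (h : IsCriticalLaw p) {x : ℝ} (hx : x ∈ Set.Icc (0 : ℝ) 1) : 0 < tail3 p x := by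
  refine lt_of_lt_of_le ?_ (h.tail3_mono le_rfl hx.1 hx.2)
  have := h.genFun_sub_self (x := 0) (by simp)
  have h0 : genFun p 0 = p 0 := by
    rw [genFun, tsum_eq_single 0 fun k hk => by simp [hk]]
    simp
  rw [h0, sub_zero, sub_zero, one_pow, one_mul] at this
  exact this ▸ h.p_zero_pos

lemma moment2_pos (h : IsCriticalLaw p) : 0 < moment2 p := h.tail3_pos (by simp)

lemma continuousOn_tail3 (h : IsCriticalLaw p) : ContinuousOn (tail3 p) (Set.Icc 0 1) :=
  (continuousOn_genFun (tailSum_iterate_nonneg h.nonneg 2)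
    (h.summable_tailSum_iterate (by omega))).congr fun _ hx => h.tail3_eq hx.1

lemma continuousOn_genFun (h : IsCriticalLaw p) : ContinuousOn (genFun p) (Set.Icc 0 1) :=
  _root_.continuousOn_genFun h.nonneg h.hasSum.summable

lemma lt_genFun (h : IsCriticalLaw p) {x : ℝ} (hx : x ∈ Set.Ico (0 : ℝ) 1) :
    0 < genFun p x - x := by
  rw [h.genFun_sub_self hx]
  have h1 := h.tail3_pos ⟨hx.1, hx.2.le⟩
  have h2 : 0 < 1 - x := by linarith [hx.2]
  positivity

/-! ### The limit generating function -/

/-- Insert f₃ = m₂ - (1 - x) f₄ and f₄ = m₃ - (1 - x) f₅ into 1 / ((1 - x)² f₃): the subtracted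
terms are its singular part at 1. -/
lemma psiCritical_eq (h : IsCriticalLaw p) {x : ℝ} (hx : x ∈ Set.Ico (0 : ℝ) 1) :
    psiCritical p x = 1 / (genFun p x - x) - moment2 p *
      (1 / moment2 p ^ 2 * (1 / (1 - x) ^ 2) + moment3 p / moment2 p ^ 3 * (1 / (1 - x))) := by
  have h1 := (h.tail3_pos ⟨hx.1, hx.2.le⟩).ne'
  have h2 : 1 - x ≠ 0 := by linarith [hx.2]
  have h3 := h.moment2_pos.ne'
  rw [h.genFun_sub_self hx, psiCritical]
  have h4 := h.one_sub_mul_tail4 hx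
  have h5 := h.one_sub_mul_tail5 hx
  have e4 : tail4 p x = (moment2 p - tail3 p x) / (1 - x) := by field_simp; linarith
  have e5 : tail5 p x = (moment3 p - tail4 p x) / (1 - x) := by field_simp; linarith
  rw [e5, e4]
  field_simp
  ring

/-- The time needed to move from `0` to `s` along the flow of the backward equation. -/
noncomputable def flowTime (p : ℕ → ℝ) (s : ℝ) : ℝ := ∫ x in (0 : ℝ)..s, 1 / (genFun p x - x)

lemma continuousOn_inv_sub (h : IsCriticalLaw p) :
    ContinuousOn (fun x => 1 / (genFun p x - x)) (Set.Ico 0 1) :=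
  continuousOn_const.div ((h.continuousOn_genFun.mono Set.Ico_subset_Icc_self).sub continuousOn_id)
    fun _ hx => (h.lt_genFun hx).ne'

lemma uIcc_subset {s : ℝ} (hs : s ∈ Set.Ico (0 : ℝ) 1) : Set.uIcc 0 s ⊆ Set.Ico 0 1 := by
  rw [Set.uIcc_of_le hs.1]
  exact fun x hx => ⟨hx.1, hx.2.trans_lt hs.2⟩

lemma intervalIntegrable_inv_sub (h : IsCriticalLaw p) {s : ℝ} (hs : s ∈ Set.Ico (0 : ℝ) 1) :
    IntervalIntegrable (fun x => 1 / (genFun p x - x)) volume 0 s :=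
  (h.continuousOn_inv_sub.mono (uIcc_subset hs)).intervalIntegrable

lemma intervalIntegrable_singular {a b s : ℝ} (hs : s ∈ Set.Ico (0 : ℝ) 1) :
    IntervalIntegrable (fun x => a * (1 / (1 - x) ^ 2) + b * (1 / (1 - x))) volume 0 s := by
  refine ContinuousOn.intervalIntegrable fun x hx => ContinuousAt.continuousWithinAt ?_
  have h2 : 1 - x ≠ 0 := by linarith [(uIcc_subset hs hx).2]
  fun_prop (disch := positivity)

lemma integral_singular {a b s : ℝ} (hs : s ∈ Set.Ico (0 : ℝ) 1) :
    ∫ x in (0 : ℝ)..s, (a * (1 / (1 - x) ^ 2) + b * (1 / (1 - x))) =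
      a * (s / (1 - s)) + b * Real.log (1 / (1 - s)) := by
  have hd : ∀ x ∈ Set.uIcc 0 s, HasDerivAt (fun x => a * (x / (1 - x)) + b * (-Real.log (1 - x)))
      (a * (1 / (1 - x) ^ 2) + b * (1 / (1 - x))) x := by
    intro x hx
    have h2 : 1 - x ≠ 0 := by linarith [(uIcc_subset hs hx).2]
    have h1 : HasDerivAt (fun x : ℝ => 1 - x) (-1) x := by
      simpa using (hasDerivAt_id x).const_sub 1
    convert! (((hasDerivAt_id x).div h1 h2).const_mul a).add ((h1.log h2).neg.const_mul b) using 1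
    simp only [id]
    field_simp
    ring
  rw [intervalIntegral.integral_eq_sub_of_hasDerivAt hd (intervalIntegrable_singular hs)]
  simp [Real.log_inv]

lemma intervalIntegrable_psiCritical (h : IsCriticalLaw p) {s : ℝ} (hs : s ∈ Set.Ico (0 : ℝ) 1) :
    IntervalIntegrable (psiCritical p) volume 0 s := by
  refine ((h.intervalIntegrable_inv_sub hs).sub
    ((intervalIntegrable_singular (a := 1 / moment2 p ^ 2) (b := moment3 p / moment2 p ^ 3)
      hs).const_mul (moment2 p))).congr fun x hx => ?_
  exact (h.psiCritical_eq (uIcc_subset hs (Set.uIoc_subset_uIcc hx))).symm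

/-- The explicit terms of `limitGF` cancel the integrated singular part, which identifies it with
the time shift between trajectories. -/
lemma limitGF_eq (h : IsCriticalLaw p) {s : ℝ} (hs : s ∈ Set.Ico (0 : ℝ) 1) :
    limitGF p s = flowTime p s / moment2 p := by
  have hm := h.moment2_pos.ne'
  rw [limitGF, intervalIntegral.integral_congr fun x hx => h.psiCritical_eq (uIcc_subset hs hx),
    intervalIntegral.integral_sub (h.intervalIntegrable_inv_sub hs)
      ((intervalIntegrable_singular hs).const_mul (moment2 p)),
    intervalIntegral.integral_const_mul, integral_singular hs, flowTime]
  field_simp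
  ring

/-! ### The renewal sequence and the coefficients of the limit generating function -/

/-- The distribution of the steps of the renewal process attached to `p`, shifted by one. -/
noncomputable def renewalStep (p : ℕ → ℝ) (i : ℕ) : ℝ := tailSum p (i + 1) / p 0

/-- The renewal sequence attached to `p`. -/
noncomputable def renewalSeq (p : ℕ → ℝ) (n : ℕ) : ℝ :=
  PowerSeries.coeff n ((1 - PowerSeries.X * PowerSeries.mk (renewalStep p))⁻¹ : PowerSeries ℝ)

lemma renewalSeq_zero (p : ℕ → ℝ) : renewalSeq p 0 = 1 := by
  simp [renewalSeq]

lemma renewalSeq_succ (p : ℕ → ℝ) (n : ℕ) : renewalSeq p (n + 1) =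
    ∑ q ∈ Finset.HasAntidiagonal.antidiagonal n, renewalStep p q.1 * renewalSeq p q.2 := by
  have h := PowerSeries.mul_inv_cancel
    (1 - PowerSeries.X * PowerSeries.mk (renewalStep p) : PowerSeries ℝ) (by simp)
  have h' := congrArg (PowerSeries.coeff (n + 1)) h
  rw [sub_mul, one_mul, map_sub, mul_assoc, PowerSeries.coeff_succ_X_mul, PowerSeries.coeff_mul,
    PowerSeries.coeff_one, if_neg n.succ_ne_zero, sub_eq_zero] at h'
  simpa [renewalSeq] using h'

lemma renewalStep_nonneg (h : IsCriticalLaw p) (i : ℕ) : 0 ≤ renewalStep p i :=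
  div_nonneg (tailSum_nonneg h.nonneg _) h.p_zero_pos.le

lemma summable_tailSum (h : IsCriticalLaw p) : Summable (tailSum p) :=
  h.summable_tailSum_iterate (n := 1) (by omega)

lemma tailSum_zero_eq (h : IsCriticalLaw p) : tailSum p 0 = 1 - p 0 := by
  have := tailSum_zero h.hasSum.summable
  rw [h.hasSum.tsum_eq] at this
  linarith

/-- By criticality all tail sums add up to 1; the first one is 1 - p₀, so the others add up to p₀.
-/
lemma hasSum_renewalStep (h : IsCriticalLaw p) : HasSum (renewalStep p) 1 := by
  have h1 := h.summable_tailSum.tsum_eq_zero_add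
  rw [← genFun_one, h.genFun_tailSum_one, h.tailSum_zero_eq] at h1
  have h2 : HasSum (fun i => tailSum p (i + 1)) (p 0) := by
    rw [((summable_nat_add_iff 1).2 h.summable_tailSum).hasSum_iff]
    linarith
  have h3 := h2.div_const (p 0)
  rwa [div_self h.p_zero_pos.ne'] at h3

lemma renewalSeq_mem (h : IsCriticalLaw p) (n : ℕ) : renewalSeq p n ∈ Set.Icc (0 : ℝ) 1 := by
  induction n using Nat.strong_induction_on with
  | _ n ih =>
    cases n with
    | zero => simp [renewalSeq_zero]
    | succ n =>
      rw [renewalSeq_succ]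
      have hle : ∀ q ∈ Finset.HasAntidiagonal.antidiagonal n, renewalSeq p q.2 ∈ Set.Icc (0 : ℝ) 1 :=
        fun q hq => ih _ (by have := Finset.HasAntidiagonal.mem_antidiagonal.1 hq; omega)
      refine ⟨Finset.sum_nonneg fun q hq =>
        mul_nonneg (h.renewalStep_nonneg _) (hle q hq).1, ?_⟩
      calc ∑ q ∈ Finset.HasAntidiagonal.antidiagonal n, renewalStep p q.1 * renewalSeq p q.2
          ≤ ∑ q ∈ Finset.HasAntidiagonal.antidiagonal n, renewalStep p q.1 :=
            Finset.sum_le_sum fun q hq =>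
              mul_le_of_le_one_right (h.renewalStep_nonneg _) (hle q hq).2
        _ = ∑ k ∈ Finset.range (n + 1), renewalStep p k :=
            Finset.Nat.sum_antidiagonal_eq_sum_range_succ (fun i _ => renewalStep p i) n
        _ ≤ 1 := sum_le_hasSum _ (fun i _ => h.renewalStep_nonneg i) h.hasSum_renewalStep

/-- The partial sums of the renewal sequence. -/
noncomputable def renewalSum (p : ℕ → ℝ) (n : ℕ) : ℝ := ∑ k ∈ Finset.range (n + 1), renewalSeq p k

lemma one_le_renewalSum (h : IsCriticalLaw p) (n : ℕ) : 1 ≤ renewalSum p n := by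
  rw [renewalSum, Finset.sum_range_succ', renewalSeq_zero]
  linarith [Finset.sum_nonneg fun k (_ : k ∈ Finset.range n) => (h.renewalSeq_mem (k + 1)).1]

lemma summable_renewalSeq (h : IsCriticalLaw p) {x : ℝ} (hx : x ∈ Set.Ico (0 : ℝ) 1) :
    Summable fun n => renewalSeq p n * x ^ n :=
  summable_mul_pow_of_le (C := 1)
    (fun n => by rw [abs_of_nonneg (h.renewalSeq_mem n).1]; exact (h.renewalSeq_mem n).2) hx.1 hx.2

lemma genFun_renewalSeq (h : IsCriticalLaw p) {x : ℝ} (hx : x ∈ Set.Ico (0 : ℝ) 1) :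
    genFun (renewalSeq p) x * (1 - x * genFun (renewalStep p) x) = 1 := by
  have hU := h.summable_renewalSeq hx
  have hQ := summable_genFun h.renewalStep_nonneg h.hasSum_renewalStep.summable hx.1 hx.2.le
  have e : genFun (renewalStep p) x * genFun (renewalSeq p) x =
      ∑' n, renewalSeq p (n + 1) * x ^ n := by
    rw [genFun, genFun, tsum_mul_tsum_eq_tsum_sum_antidiagonal_of_summable_norm hQ.norm hU.norm]
    refine tsum_congr fun n => ?_
    rw [renewalSeq_succ, Finset.sum_mul]
    refine Finset.sum_congr rfl fun q hq => ?_
    rw [← Finset.HasAntidiagonal.mem_antidiagonal.1 hq, pow_add]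
    ring
  have e2 : genFun (renewalSeq p) x = 1 + x * ∑' n, renewalSeq p (n + 1) * x ^ n := by
    conv_lhs => rw [genFun, hU.tsum_eq_zero_add, renewalSeq_zero]
    rw [← tsum_mul_left, pow_zero, mul_one]
    congr 1
    exact tsum_congr fun n => by ring
  rw [← e] at e2
  linarith

/-- Let Q and U be the generating functions of the steps and of the renewal sequence. Then f(x) - x
= p₀ (1 - x) (1 - x Q(x)) and U (1 - x Q) = 1. The remaining factor 1 / (1 - x) turns U into partial
sums. -/
lemma hasSum_renewalSum (h : IsCriticalLaw p) {x : ℝ} (hx : x ∈ Set.Ico (0 : ℝ) 1) :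
    HasSum (fun n => renewalSum p n / p 0 * x ^ n) (1 / (genFun p x - x)) := by
  have hU := h.summable_renewalSeq hx
  have hG := summable_geometric_of_lt_one hx.1 hx.2
  have hxne : 1 - x ≠ 0 := by linarith [hx.2]
  have hA : genFun (tailSum p) x = 1 - p 0 + x * (p 0 * genFun (renewalStep p) x) := by
    rw [genFun, (summable_genFun (tailSum_nonneg h.nonneg) h.summable_tailSum hx.1
      hx.2.le).tsum_eq_zero_add, h.tailSum_zero_eq, genFun, ← tsum_mul_left, ← tsum_mul_left,
      pow_zero, mul_one]
    congr 1
    refine tsum_congr fun n => ?_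
    have := h.p_zero_pos.ne'
    rw [renewalStep]
    field_simp
    ring
  have hf := h.one_sub_mul_tailSum hx
  have hval : genFun (renewalSeq p) x * (1 - x)⁻¹ / p 0 = 1 / (genFun p x - x) := by
    have h1 := h.genFun_renewalSeq hx
    have h2 := h.p_zero_pos.ne'
    have h3 := (h.lt_genFun hx).ne'
    have h4 : genFun p x - x = (1 - x) * p 0 * (1 - x * genFun (renewalStep p) x) := by
      rw [hA] at hf
      linarith
    rw [h4] at h3 ⊢
    have h5 : 1 - x * genFun (renewalStep p) x ≠ 0 := right_ne_zero_of_mul h3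
    rw [eq_div_of_mul_eq h5 h1]
    field_simp
  have hC := hasSum_sum_range_mul_of_summable_norm hU.norm hG.norm
  rw [tsum_geometric_of_lt_one hx.1 hx.2] at hC
  rw [← hval]
  refine (hC.div_const (p 0)).congr_fun fun n => ?_
  rw [renewalSum, div_mul_eq_mul_div, Finset.sum_mul]
  congr 1
  refine Finset.sum_congr rfl fun k hk => ?_
  rw [mul_assoc, ← pow_add, Nat.add_sub_cancel' (Nat.lt_succ_iff.1 (Finset.mem_range.1 hk))]

/-- The coefficients of the limit generating function. -/
noncomputable def limitCoeff (p : ℕ → ℝ) (k : ℕ) : ℝ :=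
  renewalSum p (k - 1) / p 0 / k / moment2 p

/-- Nonvanishing lets convergence of the rescaled probabilities be restated as asymptotic
equivalence. -/
lemma limitCoeff_pos (h : IsCriticalLaw p) {k : ℕ} (hk : 0 < k) : 0 < limitCoeff p k := by
  have h1 := h.one_le_renewalSum (k - 1)
  have h2 := h.p_zero_pos
  have h3 := h.moment2_pos
  have h4 : (0 : ℝ) < k := by exact_mod_cast hk
  unfold limitCoeff
  positivity

/-- Termwise integration; the convergent series of nonnegative terms at the endpoint `s` dominates.
-/
lemma hasSum_flowTime (h : IsCriticalLaw p) {s : ℝ} (hs : s ∈ Set.Ico (0 : ℝ) 1) :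
    HasSum (fun n : ℕ => renewalSum p n / p 0 * (s ^ (n + 1) / (n + 1))) (flowTime p s) := by
  have hnn : ∀ n, 0 ≤ renewalSum p n / p 0 := fun n =>
    div_nonneg (zero_le_one.trans (h.one_le_renewalSum n)) h.p_zero_pos.le
  have hmem : ∀ x ∈ Set.uIoc 0 s, x ∈ Set.Ico (0 : ℝ) 1 :=
    fun x hx => uIcc_subset hs (Set.uIoc_subset_uIcc hx)
  have hI := intervalIntegral.hasSum_integral_of_dominated_convergence (μ := volume) (a := 0)
    (b := s) (F := fun n x => renewalSum p n / p 0 * x ^ n) (f := fun x => 1 / (genFun p x - x))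
    (fun n _ => renewalSum p n / p 0 * s ^ n)
    (fun n => by fun_prop)
    (fun n => Eventually.of_forall fun x hx => by
      rw [Set.uIoc_of_le hs.1] at hx
      rw [norm_mul, norm_pow, Real.norm_of_nonneg (hnn n), Real.norm_of_nonneg hx.1.le]
      exact mul_le_mul_of_nonneg_left (pow_le_pow_left₀ hx.1.le hx.2 n) (hnn n))
    (Eventually.of_forall fun x _ => (h.hasSum_renewalSum hs).summable)
    (by simp)
    (Eventually.of_forall fun x hx => h.hasSum_renewalSum (hmem x hx))
  refine hI.congr_fun fun n => ?_
  rw [intervalIntegral.integral_const_mul, integral_pow]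
  simp

lemma hasSum_limitCoeff (h : IsCriticalLaw p) {s : ℝ} (hs : s ∈ Set.Ico (0 : ℝ) 1) :
    HasSum (fun n : ℕ => limitCoeff p (n + 1) * s ^ (n + 1)) (limitGF p s) := by
  rw [h.limitGF_eq hs]
  refine ((h.hasSum_flowTime hs).div_const (moment2 p)).congr_fun fun n => ?_
  simp only [limitCoeff, Nat.add_sub_cancel, Nat.cast_add, Nat.cast_one]
  ring

end IsCriticalLaw

/-! ### Asymptotics of functions whose derivative converges -/

/-- Mean value theorem on [t, t + c], with an intermediate point that goes to infinity with `t`. -/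
lemma tendsto_sub_shift_of_tendsto_deriv {A A' : ℝ → ℝ} {m c : ℝ} (hc : 0 ≤ c)
    (hA : ∀ t, 0 < t → HasDerivAt A (A' t) t) (hlim : Tendsto A' atTop (nhds m)) :
    Tendsto (fun t => A (t + c) - A t) atTop (nhds (c * m)) := by
  rcases hc.eq_or_lt with rfl | hc
  · simp
  have hξ : ∀ t : ℝ, ∃ ξ, t ≤ ξ ∧ (0 < t → A (t + c) - A t = c * A' ξ) := by
    intro t
    by_cases ht : 0 < t
    · obtain ⟨ξ, hξ, he⟩ := exists_hasDerivAt_eq_slope A A' (lt_add_of_pos_right t hc)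
        (fun x hx => (hA x (ht.trans_le hx.1)).continuousAt.continuousWithinAt)
        fun x hx => hA x (ht.trans hx.1)
      refine ⟨ξ, hξ.1.le, fun _ => ?_⟩
      rw [he, add_sub_cancel_left]
      field_simp
    · exact ⟨t, le_rfl, fun h => absurd h ht⟩
  choose ξ hξ1 hξ2 using hξ
  have h1 : Tendsto ξ atTop atTop := tendsto_atTop_mono hξ1 tendsto_id
  refine ((hlim.comp h1).const_mul c).congr' ?_
  filter_upwards [eventually_gt_atTop 0] with t ht using (hξ2 t ht).symm

lemma tendsto_div_of_tendsto_deriv {A A' : ℝ → ℝ} {m : ℝ}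
    (hA : ∀ t, 0 < t → HasDerivAt A (A' t) t) (hlim : Tendsto A' atTop (nhds m)) :
    Tendsto (fun t => A t / t) atTop (nhds m) := by
  rw [Metric.tendsto_atTop]
  intro ε hε
  obtain ⟨T₀, hT₀⟩ := Metric.tendsto_atTop.1 hlim (ε / 2) (by positivity)
  set T := max T₀ 1 with hT
  have hT1 : 1 ≤ T := le_max_right _ _
  have hbd : ∀ t, T ≤ t → |A t - m * t - (A T - m * T)| ≤ ε / 2 * (t - T) := by
    intro t ht
    have hd : ∀ x ∈ Set.Icc T t,
        HasDerivWithinAt (fun x => A x - m * x) (A' x - m) (Set.Icc T t) x := fun x hx => by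
      have hx0 : 0 < x := by linarith [hx.1]
      have hd := (hA x hx0).fun_sub ((hasDerivAt_id' x).const_mul m)
      rw [mul_one] at hd
      exact hd.hasDerivWithinAt
    have := (convex_Icc T t).norm_image_sub_le_of_norm_hasDerivWithin_le hd (C := ε / 2)
      (fun x hx => (hT₀ x ((le_max_left _ _).trans hx.1)).le) (Set.left_mem_Icc.2 ht)
      (Set.right_mem_Icc.2 ht)
    rwa [Real.norm_eq_abs, Real.norm_of_nonneg (by linarith : 0 ≤ t - T)] at this
  -- Beyond this time the fixed error at `T` is less than ε t / 2; the drift accumulated since `T`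
  -- contributes at most the other half.
  refine ⟨max T (2 * |A T - m * T| / ε + 1), fun t ht => ?_⟩
  have htT : T ≤ t := (le_max_left _ _).trans ht
  have ht0 : 0 < t := by linarith
  have h1 : 2 * |A T - m * T| / ε < t := by linarith [(le_max_right T _).trans ht]
  rw [div_lt_iff₀ hε] at h1
  have h2 := hbd t htT
  rw [Real.dist_eq, show A t / t - m = (A t - m * t) / t by field_simp, abs_div, abs_of_pos ht0,
    div_lt_iff₀ ht0]
  have h3 : |A t - m * t| ≤ |A t - m * t - (A T - m * T)| + |A T - m * T| := by
    simpa using abs_add_le (A t - m * t - (A T - m * T)) (A T - m * T)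
  nlinarith

/-! ### The flow of the backward equation -/

/-- A trajectory of the backward equation `φ' = f(φ) - φ`. -/
structure IsFlow (p : ℕ → ℝ) (φ : ℝ → ℝ) : Prop where
  continuousOn : ContinuousOn φ (Set.Ici 0)
  mem : ∀ t, 0 ≤ t → φ t ∈ Set.Ico (0 : ℝ) 1
  deriv : ∀ t, 0 < t → HasDerivAt φ (genFun p (φ t) - φ t) t

namespace IsCriticalLaw

variable {p : ℕ → ℝ} {φ : ℝ → ℝ}

lemma hasDerivAt_flowTime (h : IsCriticalLaw p) {x : ℝ} (hx : x ∈ Set.Ioo (0 : ℝ) 1) :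
    HasDerivAt (flowTime p) (1 / (genFun p x - x)) x := by
  have hc := h.continuousOn_inv_sub.mono Set.Ioo_subset_Ico_self
  exact intervalIntegral.integral_hasDerivAt_right
    (h.intervalIntegrable_inv_sub ⟨hx.1.le, hx.2⟩)
    (hc.stronglyMeasurableAtFilter isOpen_Ioo x hx) (hc.continuousAt (Ioo_mem_nhds hx.1 hx.2))

lemma continuousOn_flowTime (h : IsCriticalLaw p) {b : ℝ} (hb : b ∈ Set.Ico (0 : ℝ) 1) :
    ContinuousOn (flowTime p) (Set.Icc 0 b) := by
  have := intervalIntegral.continuousOn_primitive_interval (μ := volume)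
    ((h.continuousOn_inv_sub.mono (uIcc_subset hb)).integrableOn_compact isCompact_uIcc)
  rwa [Set.uIcc_of_le hb.1] at this

lemma flowTime_strictMonoOn (h : IsCriticalLaw p) {b : ℝ} (hb : b ∈ Set.Ico (0 : ℝ) 1) :
    StrictMonoOn (flowTime p) (Set.Icc 0 b) := by
  refine strictMonoOn_of_deriv_pos (convex_Icc 0 b) (h.continuousOn_flowTime hb) fun x hx => ?_
  rw [interior_Icc] at hx
  have hx' : x ∈ Set.Ioo (0 : ℝ) 1 := ⟨hx.1, hx.2.trans hb.2⟩
  rw [(h.hasDerivAt_flowTime hx').deriv]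
  exact one_div_pos.2 (h.lt_genFun ⟨hx'.1.le, hx'.2⟩)

lemma flowTime_lt (h : IsCriticalLaw p) {x y : ℝ} (hx : 0 ≤ x) (hxy : x < y) (hy : y < 1) :
    flowTime p x < flowTime p y :=
  h.flowTime_strictMonoOn (b := y) ⟨hx.trans hxy.le, hy⟩ ⟨hx, hxy.le⟩ ⟨hx.trans hxy.le, le_rfl⟩ hxy

lemma flowTime_zero (p : ℕ → ℝ) : flowTime p 0 = 0 := by simp [flowTime]

lemma flowTime_nonneg (h : IsCriticalLaw p) {s : ℝ} (hs : s ∈ Set.Ico (0 : ℝ) 1) :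
    0 ≤ flowTime p s := by
  rcases hs.1.eq_or_lt with rfl | h0
  · rw [flowTime_zero]
  · exact (flowTime_zero p ▸ h.flowTime_lt le_rfl h0 hs.2).le

lemma flow_strictMonoOn (h : IsCriticalLaw p) (hφ : IsFlow p φ) :
    StrictMonoOn φ (Set.Ici 0) := by
  refine strictMonoOn_of_deriv_pos (convex_Ici 0) hφ.continuousOn fun t ht => ?_
  rw [interior_Ici] at ht
  rw [(hφ.deriv t ht).deriv]
  exact h.lt_genFun (hφ.mem t (le_of_lt ht))

/-- Along a trajectory `flowTime p` has derivative 1. The mean value theorem asks for this only at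
interior times, so a start at 0 causes no difficulty. -/
lemma flowTime_flow (h : IsCriticalLaw p) (hφ : IsFlow p φ) {t : ℝ} (ht : 0 ≤ t) :
    flowTime p (φ t) = flowTime p (φ 0) + t := by
  rcases ht.eq_or_lt with rfl | ht0
  · simp
  have hmono := h.flow_strictMonoOn hφ
  have hcont : ContinuousOn (fun u => flowTime p (φ u)) (Set.Icc 0 t) := by
    refine (h.continuousOn_flowTime (hφ.mem t ht)).comp
      (hφ.continuousOn.mono Set.Icc_subset_Ici_self) fun u hu => ⟨(hφ.mem u hu.1).1, ?_⟩
    exact hmono.monotoneOn hu.1 (Set.mem_Ici.2 ht) hu.2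
  have hd : ∀ u ∈ Set.Ioo 0 t, HasDerivAt (fun u => flowTime p (φ u)) 1 u := by
    intro u hu
    have hpos : 0 < φ u := (hφ.mem 0 le_rfl).1.trans_lt
      (hmono (Set.mem_Ici.2 le_rfl) (Set.mem_Ici.2 hu.1.le) hu.1)
    have hlt := (hφ.mem u hu.1.le).2
    have := (h.hasDerivAt_flowTime ⟨hpos, hlt⟩).comp u (hφ.deriv u hu.1)
    rwa [one_div_mul_cancel (h.lt_genFun ⟨hpos.le, hlt⟩).ne'] at this
  obtain ⟨ξ, -, he⟩ := exists_hasDerivAt_eq_slope _ (fun _ => 1) ht0 hcont hd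
  rw [sub_zero, eq_div_iff ht0.ne'] at he
  linarith

/-- `flowTime` is finite at every level below 1 but grows linearly along the trajectory, so each
such level is passed. -/
lemma flow_tendsto_one (h : IsCriticalLaw p) (hφ : IsFlow p φ) :
    Tendsto φ atTop (nhds 1) := by
  refine tendsto_order.2 ⟨fun a ha => ?_, fun a ha => ?_⟩
  · have hb : max a 0 ∈ Set.Ico (0 : ℝ) 1 := ⟨le_max_right _ _, max_lt ha one_pos⟩
    filter_upwards [eventually_gt_atTop (flowTime p (max a 0)), eventually_ge_atTop 0] with t ht ht0
    by_contra hle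
    have hle' : φ t ≤ max a 0 := (not_lt.1 hle).trans (le_max_left _ _)
    have h1 := (h.flowTime_strictMonoOn hb).monotoneOn ⟨(hφ.mem t ht0).1, hle'⟩ ⟨hb.1, le_rfl⟩ hle'
    rw [h.flowTime_flow hφ ht0] at h1
    linarith [h.flowTime_nonneg (hφ.mem 0 le_rfl)]
  · filter_upwards [eventually_ge_atTop 0] with t ht using (hφ.mem t ht).2.trans ha

/-- A trajectory is the trajectory started from `0`, after a time shift. -/
lemma flow_eq_shift (h : IsCriticalLaw p) {ψ : ℝ → ℝ} (hφ : IsFlow p φ) (hψ : IsFlow p ψ)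
    (hφ0 : φ 0 = 0) {t : ℝ} (ht : 0 ≤ t) : ψ t = φ (t + flowTime p (ψ 0)) := by
  have h0 := h.flowTime_nonneg (hψ.mem 0 le_rfl)
  have e1 := h.flowTime_flow hψ ht
  have e2 := h.flowTime_flow hφ (add_nonneg ht h0)
  rw [hφ0, flowTime_zero, zero_add] at e2
  replace e2 : flowTime p (φ (t + flowTime p (ψ 0))) = flowTime p (ψ t) := by linarith
  have m1 := hψ.mem t ht
  have m2 := hφ.mem _ (add_nonneg ht h0)
  rcases lt_trichotomy (ψ t) (φ (t + flowTime p (ψ 0))) with hlt | he | hlt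
  · exact absurd e2 (h.flowTime_lt m1.1 hlt m2.2).ne'
  · exact he
  · exact absurd e2 (h.flowTime_lt m2.1 hlt m1.2).ne

/-- The rate at which two trajectories approach each other. -/
theorem tendsto_sq_mul_flow_sub (h : IsCriticalLaw p) {ψ : ℝ → ℝ} (hφ : IsFlow p φ)
    (hψ : IsFlow p ψ) (hφ0 : φ 0 = 0) :
    Tendsto (fun t => t ^ 2 * (ψ t - φ t)) atTop (nhds (limitGF p (ψ 0))) := by
  set c := flowTime p (ψ 0) with hc
  have hc0 : 0 ≤ c := h.flowTime_nonneg (hψ.mem 0 le_rfl)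
  have hm := h.moment2_pos.ne'
  -- This change of variable removes the double zero of f(x) - x at 1, leaving the convergent speed
  -- f₃(φ).
  set A : ℝ → ℝ := fun t => 1 / (1 - φ t) with hAdef
  have hne : ∀ t, 0 ≤ t → 1 - φ t ≠ 0 := fun t ht => by linarith [(hφ.mem t ht).2]
  have hA : ∀ t, 0 < t → HasDerivAt A (tail3 p (φ t)) t := by
    intro t ht
    have h1 := ((hφ.deriv t ht).const_sub 1).inv (hne t ht.le)
    have h2 := hne t ht.le
    rw [h.genFun_sub_self (hφ.mem t ht.le), neg_neg, mul_div_cancel_left₀ _ (pow_ne_zero 2 h2)] at h1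
    simpa [hAdef, Function.comp_def, Pi.inv_def] using h1
  have hlim : Tendsto (fun t => tail3 p (φ t)) atTop (nhds (moment2 p)) := by
    have h1 : Tendsto φ atTop (nhdsWithin 1 (Set.Icc 0 1)) :=
      tendsto_nhdsWithin_iff.2 ⟨h.flow_tendsto_one hφ, by
        filter_upwards [eventually_ge_atTop 0] with t ht
          using Set.Ico_subset_Icc_self (hφ.mem t ht)⟩
    exact (h.continuousOn_tail3 1 (by simp)).tendsto.comp h1
  have hshift := tendsto_sub_shift_of_tendsto_deriv hc0 hA hlim
  have hdiv := tendsto_div_of_tendsto_deriv hA hlim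
  have hdiv' : Tendsto (fun t => A (t + c) / t) atTop (nhds (moment2 p)) := by
    have := hdiv.add (hshift.mul tendsto_inv_atTop_zero)
    rw [mul_zero, add_zero] at this
    refine this.congr fun t => ?_
    ring
  -- This is t² (A(t + c) - A(t)) / (A(t) A(t + c)), with limit c m₂ / m₂ / m₂.
  have hfin := (hshift.div hdiv hm).div hdiv' hm
  rw [h.limitGF_eq (hψ.mem 0 le_rfl), ← hc, ← mul_div_cancel_right₀ c hm]
  refine hfin.congr' ?_
  filter_upwards [eventually_gt_atTop 0] with t ht
  have h1 := hne t ht.le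
  have h2 := hne (t + c) (by positivity)
  rw [h.flow_eq_shift hφ hψ hφ0 ht.le, ← hc]
  simp only [Pi.div_apply, hAdef]
  field_simp
  ring

end IsCriticalLaw

/-! ### Convergence of coefficients -/

/-- If power series with uniformly bounded coefficients tend to zero at all small positive
arguments, then their coefficients tend to zero. -/
theorem tendsto_coeff_of_tendsto_powerSeries {ι : Type*} {l : Filter ι} {c : ι → ℕ → ℝ} {C r : ℝ}
    (hr : 0 < r) (hC : ∀ᶠ t in l, ∀ k, |c t k| * r ^ k ≤ C)
    (hlim : ∀ s ∈ Set.Ioo 0 r, ∃ F : ι → ℝ,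
      (∀ᶠ t in l, HasSum (fun k => c t k * s ^ k) (F t)) ∧ Tendsto F l (nhds 0)) (k : ℕ) :
    Tendsto (fun t => c t k) l (nhds 0) := by
  rcases l.eq_or_neBot with rfl | hl
  · exact tendsto_bot
  have hC0 : 0 ≤ C := by
    obtain ⟨t, ht⟩ := hC.exists
    exact (mul_nonneg (abs_nonneg _) (pow_nonneg hr.le 0)).trans (ht 0)
  induction k using Nat.strong_induction_on with
  | _ k ih =>
    rw [Metric.tendsto_nhds]
    intro ε hε
    -- At s = r x, after division by s ^ k, the terms beyond `k` are dominated by a geometric series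
    -- of sum C / r ^ k * x * 2, uniformly in `t`.
    obtain ⟨x, hx0, hx1, hxε⟩ : ∃ x : ℝ, 0 < x ∧ x ≤ 1 / 2 ∧ C / r ^ k * x * 2 < ε / 2 := by
      have hCr : 0 ≤ C / r ^ k := by positivity
      refine ⟨min (1 / 2) (ε / (8 * (C / r ^ k + 1))), by positivity, min_le_left _ _, ?_⟩
      have h1 : min (1 / 2) (ε / (8 * (C / r ^ k + 1))) ≤ ε / (8 * (C / r ^ k + 1)) :=
        min_le_right _ _
      have h2 : C / r ^ k * min (1 / 2) (ε / (8 * (C / r ^ k + 1))) ≤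
          (C / r ^ k + 1) * (ε / (8 * (C / r ^ k + 1))) :=
        mul_le_mul (by linarith) h1 (by positivity) (by positivity)
      have h3 : (C / r ^ k + 1) * (ε / (8 * (C / r ^ k + 1))) = ε / 8 := by
        have : C / r ^ k + 1 ≠ 0 := by positivity
        field_simp
      linarith
    set s := r * x with hs
    have hs0 : 0 < s := by positivity
    obtain ⟨F, hF, hF0⟩ := hlim s ⟨hs0, by rw [hs]; nlinarith⟩
    -- By induction the lower coefficients vanish in the limit, so this quotient, which is c t k
    -- plus the small tail, tends to 0.
    have hmain : Tendsto (fun t => (F t - ∑ j ∈ Finset.range k, c t j * s ^ j) / s ^ k) l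
        (nhds 0) := by
      have h1 : Tendsto (fun t => ∑ j ∈ Finset.range k, c t j * s ^ j) l
          (nhds (∑ j ∈ Finset.range k, 0 * s ^ j)) :=
        tendsto_finsetSum _ fun j hj => (ih j (Finset.mem_range.1 hj)).mul_const _
      simpa using (hF0.sub h1).div_const (s ^ k)
    filter_upwards [hC, hF, Metric.tendsto_nhds.1 hmain (ε / 2) (by positivity)] with t ht hFt hε2
    have hsum : HasSum (fun j => c t (j + k) * s ^ (j + k))
        (F t - ∑ j ∈ Finset.range k, c t j * s ^ j) :=
      (hasSum_nat_add_iff' k).2 hFt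
    have hsum1 := (hasSum_nat_add_iff' 1).2 (hsum.div_const (s ^ k))
    have hbound : ∀ j, ‖c t (j + 1 + k) * s ^ (j + 1 + k) / s ^ k‖ ≤ C / r ^ k * x * (1 / 2) ^ j := by
      intro j
      rw [pow_add s (j + 1) k, ← mul_assoc, mul_div_cancel_right₀ _ (pow_ne_zero k hs0.ne'),
        norm_mul, norm_pow, Real.norm_of_nonneg hs0.le, Real.norm_eq_abs, hs, mul_pow]
      have h1 := ht (j + 1 + k)
      rw [pow_add] at h1
      have h2 : |c t (j + 1 + k)| * r ^ (j + 1) ≤ C / r ^ k := by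
        rw [le_div_iff₀ (by positivity)]
        linarith
      have h3 : x ^ (j + 1) ≤ x * (1 / 2) ^ j := by
        rw [pow_succ, mul_comm]
        exact mul_le_mul_of_nonneg_left (pow_le_pow_left₀ hx0.le hx1 j) hx0.le
      calc |c t (j + 1 + k)| * (r ^ (j + 1) * x ^ (j + 1))
          = |c t (j + 1 + k)| * r ^ (j + 1) * x ^ (j + 1) := by ring
        _ ≤ C / r ^ k * (x * (1 / 2) ^ j) :=
            mul_le_mul h2 h3 (by positivity) (by positivity)
        _ = _ := by ring
    have htail := tsum_of_norm_bounded (hasSum_geometric_two.mul_left (C / r ^ k * x)) hbound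
    rw [hsum1.tsum_eq, Finset.sum_range_one, zero_add,
      mul_div_cancel_right₀ _ (pow_ne_zero k hs0.ne'), Real.norm_eq_abs] at htail
    rw [Real.dist_eq, sub_zero] at hε2 ⊢
    have h5 := abs_sub_abs_le_abs_sub (c t k) ((F t - ∑ j ∈ Finset.range k, c t j * s ^ j) / s ^ k)
    rw [abs_sub_comm] at h5
    linarith

lemma bounded_of_hasSum {c : ℕ → ℝ} {r a : ℝ} (hr : 0 ≤ r)
    (h : HasSum (fun k => c k * r ^ k) a) : ∃ C, ∀ k, |c k| * r ^ k ≤ C := by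
  refine ⟨∑' k, ‖c k * r ^ k‖, fun k => ?_⟩
  have := h.summable.norm.le_tsum k fun j _ => norm_nonneg _
  rwa [norm_mul, norm_pow, Real.norm_of_nonneg hr, Real.norm_eq_abs] at this

/-- Uniqueness of the coefficients of a power series. -/
lemma coeff_eq_zero_of_hasSum_zero {c : ℕ → ℝ} {r : ℝ} (hr : 0 < r)
    (h : ∀ s ∈ Set.Ioc 0 r, HasSum (fun k => c k * s ^ k) 0) (k : ℕ) : c k = 0 := by
  obtain ⟨C, hC⟩ := bounded_of_hasSum hr.le (h r ⟨hr, le_rfl⟩)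
  exact tendsto_nhds_unique tendsto_const_nhds
    (tendsto_coeff_of_tendsto_powerSeries (l := (atTop : Filter ℕ)) (c := fun _ => c) hr
      (Eventually.of_forall fun _ => hC) (fun s hs => ⟨fun _ => 0,
        Eventually.of_forall fun _ => h s ⟨hs.1, hs.2.le⟩, tendsto_const_nhds⟩) k)

lemma hasSum_div_of_hasSum_succ {c : ℕ → ℝ} {s a : ℝ} (hs : s ≠ 0)
    (h : HasSum (fun k => c (k + 1) * s ^ (k + 1)) a) :
    HasSum (fun k => c (k + 1) * s ^ k) (a / s) := by
  refine (h.div_const s).congr_fun fun k => ?_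
  rw [pow_succ]
  field_simp

/-! ### The population size -/

section

variable {Ω : Type*} [MeasurableSpace Ω] {μ : Measure Ω} [IsProbabilityMeasure μ] {p : ℕ → ℝ}
  {L : List ℕ → Ω → ℝ} {X : List ℕ → Ω → ℕ}

lemma IsCriticalLaw.exists_flow (hp : IsCriticalLaw p) (h : IsBranchingMechanism μ p L X) {s : ℝ}
    (hs : s ∈ Set.Ico (0 : ℝ) 1) : ∃ φ : ℝ → ℝ, IsFlow p φ ∧ φ 0 = s ∧
      ∀ t, HasSum (fun k => sizeProb μ L X t k * s ^ k) (φ t) := by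
  obtain ⟨φ, h1, h2, h3, h4, h5⟩ := h.exists_backward_solution hp.nonneg hp.hasSum hs
  exact ⟨φ, ⟨h3, h4, h5⟩, h2, h1⟩

/-- Convergence of the generating functions of the rescaled size probabilities. -/
lemma IsCriticalLaw.exists_hasSum_sizeProb (hp : IsCriticalLaw p)
    (h : IsBranchingMechanism μ p L X) {s : ℝ} (hs : s ∈ Set.Ico (0 : ℝ) 1) :
    ∃ F : ℝ → ℝ, (∀ t, HasSum (fun k => t ^ 2 * sizeProb μ L X t (k + 1) * s ^ (k + 1)) (F t)) ∧
      Tendsto F atTop (nhds (limitGF p s)) := by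
  obtain ⟨φ, hφ, hφ0, hφs⟩ := hp.exists_flow h (s := 0) (by simp)
  obtain ⟨ψ, hψ, hψ0, hψs⟩ := hp.exists_flow h hs
  refine ⟨fun t => t ^ 2 * (ψ t - φ t), fun t => ?_, ?_⟩
  -- The trajectory from s = 0 is the extinction probability; subtracting it removes the k = 0 term.
  · have e : φ t = sizeProb μ L X t 0 := by
      rw [← (hφs t).tsum_eq, tsum_eq_single 0 fun k hk => by simp [hk]]
      simp
    have h1 := ((hasSum_nat_add_iff' 1).2 (hψs t)).mul_left (t ^ 2)
    simp only [Finset.sum_range_one, pow_zero, mul_one, ← e] at h1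
    exact h1.congr_fun fun k => mul_assoc _ _ _
  · have := hp.tendsto_sq_mul_flow_sub hφ hψ hφ0
    rwa [hψ0] at this

/-- The coefficient criterion is applied to the differences from the limit coefficients, with
indices lowered by one and the series divided by s. -/
theorem IsCriticalLaw.tendsto_sq_mul_sizeProb (hp : IsCriticalLaw p)
    (h : IsBranchingMechanism μ p L X) (k : ℕ) :
    Tendsto (fun t => t ^ 2 * sizeProb μ L X t (k + 1)) atTop (nhds (limitCoeff p (k + 1))) := by
  rw [← tendsto_sub_nhds_zero_iff]
  have hhalf : (1 / 2 : ℝ) ∈ Set.Ico (0 : ℝ) 1 := by norm_num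
  obtain ⟨C, hC⟩ := bounded_of_hasSum (by norm_num : (0 : ℝ) ≤ 1 / 2)
    (hasSum_div_of_hasSum_succ (by norm_num) (hp.hasSum_limitCoeff hhalf))
  obtain ⟨F, hF, hFl⟩ := hp.exists_hasSum_sizeProb h hhalf
  refine tendsto_coeff_of_tendsto_powerSeries (r := 1 / 2)
    (c := fun t k => t ^ 2 * sizeProb μ L X t (k + 1) - limitCoeff p (k + 1))
    (C := (limitGF p (1 / 2) + 1) / (1 / 2) + C) (by norm_num) ?_ ?_ k
  -- The terms at s = 1/2 are nonnegative, so each is at most their sum, which eventually stays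
  -- below its limit plus 1.
  · filter_upwards [hFl.eventually_le_const (lt_add_one _)] with t ht j
    have hnn : ∀ i, 0 ≤ t ^ 2 * sizeProb μ L X t (i + 1) :=
      fun i => mul_nonneg (sq_nonneg t) measureReal_nonneg
    have h1 := (hF t).summable.le_tsum j fun i _ => mul_nonneg (hnn i) (by positivity)
    rw [(hF t).tsum_eq, pow_succ _ j, ← mul_assoc, ← le_div_iff₀ (by norm_num)] at h1
    have h2 : F t / (1 / 2) ≤ (limitGF p (1 / 2) + 1) / (1 / 2) :=
      div_le_div_of_nonneg_right ht (by norm_num)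
    have h3 := abs_sub (t ^ 2 * sizeProb μ L X t (j + 1)) (limitCoeff p (j + 1))
    rw [abs_of_nonneg (hnn j)] at h3
    have h4 := mul_le_mul_of_nonneg_right h3 (by positivity : (0 : ℝ) ≤ (1 / 2) ^ j)
    rw [add_mul] at h4
    linarith [hC j]
  · intro s hs
    have hs1 : s ∈ Set.Ico (0 : ℝ) 1 := ⟨hs.1.le, by linarith [hs.2]⟩
    obtain ⟨G, hG, hGl⟩ := hp.exists_hasSum_sizeProb h hs1
    refine ⟨fun t => (G t - limitGF p s) / s, Eventually.of_forall fun t => ?_, ?_⟩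
    · refine (((hG t).sub (hp.hasSum_limitCoeff hs1)).div_const s).congr_fun fun j => ?_
      have := hs.1.ne'
      field_simp
      ring
    · simpa using (hGl.sub_const (limitGF p s)).div_const s

end

/-! ### Uniqueness of the limit sequence and the main theorem -/

lemma IsCriticalLaw.eq_limitCoeff_iff {p : ℕ → ℝ} (hp : IsCriticalLaw p) (g : ℕ+ → ℝ) :
    (∀ s ∈ Set.Ico (0 : ℝ) 1, HasSum (fun k : ℕ+ => g k * s ^ (k : ℕ)) (limitGF p s)) ↔
      g = fun k : ℕ+ => limitCoeff p k := by
  constructor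
  · intro hg
    set d : ℕ → ℝ := fun k => g k.succPNat - limitCoeff p (k + 1) with hd
    have hz : ∀ k, d k = 0 := by
      -- Two sequences with the same sum differ by a power series vanishing on (0, 1/2]; dividing by
      -- s aligns the index shift.
      refine coeff_eq_zero_of_hasSum_zero (r := 1 / 2) (by norm_num) fun s hs => ?_
      have hs1 : s ∈ Set.Ico (0 : ℝ) 1 := ⟨hs.1.le, by linarith [hs.2]⟩
      have h1 := hg s hs1
      rw [← Equiv.pnatEquivNat.symm.hasSum_iff] at h1
      have h2 := (h1.sub (hp.hasSum_limitCoeff hs1)).div_const s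
      rw [sub_self, zero_div] at h2
      refine h2.congr_fun fun j => ?_
      have := hs.1.ne'
      simp only [hd, Function.comp, Equiv.pnatEquivNat_symm_apply, Nat.succPNat_coe, Nat.succ_eq_add_one]
      field_simp
      ring
    funext k
    have := hz k.natPred
    simp only [hd, PNat.succPNat_natPred, PNat.natPred_add_one] at this
    exact sub_eq_zero.1 this
  · rintro rfl s hs
    rw [← Equiv.pnatEquivNat.symm.hasSum_iff]
    exact (hp.hasSum_limitCoeff hs)

theorem mainTheorem12 {Ω : Type*} [MeasurableSpace Ω] (μ : Measure Ω) [IsProbabilityMeasure μ]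
    (p : ℕ → ℝ) (hp_nonneg : ∀ k, 0 ≤ p k) (hp_sum : HasSum p 1) (hp_one : p 1 ≠ 1)
    (hp_mean : HasSum (fun k : ℕ => (k : ℝ) * p k) 1)
    (hp_log : Summable (fun k : ℕ => p k * (k : ℝ) ^ 3 * Real.log k))
    (L : List ℕ → Ω → ℝ) (X : List ℕ → Ω → ℕ) (hLX : IsBranchingMechanism μ p L X) :
    (∀ s ∈ Set.Ico (0 : ℝ) 1, IntervalIntegrable (psiCritical p) volume 0 s) ∧
    ∃ h : ℕ+ → ℝ,
      (∀ g : ℕ+ → ℝ,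
        (∀ s ∈ Set.Ico (0 : ℝ) 1, HasSum (fun k : ℕ+ => g k * s ^ (k : ℕ)) (limitGF p s)) ↔
          g = h) ∧
      ∀ k : ℕ+,
        (fun t : ℝ => μ.real
          {ω | populationSize (fun u => L u ω) (fun u => X u ω) t = ((k : ℕ) : ℕ∞)})
          ~[atTop] (fun t : ℝ => h k / t ^ 2) := by
  have hp := IsCriticalLaw.of_summable_log hp_nonneg hp_sum hp_one hp_mean hp_log
  refine ⟨fun s hs => hp.intervalIntegrable_psiCritical hs, fun k => IsCriticalLaw.limitCoeff p k,
    hp.eq_limitCoeff_iff, fun k => ?_⟩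
  have hk := (hp.limitCoeff_pos k.pos).ne'
  refine isEquivalent_of_tendsto_one ?_
  have h := (hp.tendsto_sq_mul_sizeProb hLX k.natPred).div_const (IsCriticalLaw.limitCoeff p k)
  rw [PNat.natPred_add_one, div_self hk] at h
  refine h.congr fun t => ?_
  simp only [Pi.div_apply, sizeProb]
  rw [div_div_eq_mul_div, mul_comm]
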